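/- Let $\mathcal M$ be a (connected, boundaryless, finite-dimensional) smooth Riemannian manifold with Riemannian distance $d$, and let $\mathcal X\subseteq\mathcal M$ be compact and geodesically convex: any $x,y\in\mathcal X$ are joined by a unique minimizing geodesic of $\mathcal M$ on $[0,1]$, denoted $\gamma_{x,y}$, and it stays in $\mathcal X$. Write $\mathrm{Exp}_x^{-1}(y)=\dot\gamma_{x,y}(0)$, and let $\Gamma_x^y:T_x\mathcal M\to T_y\mathcal M$ be parallel transport along $\gamma_{x,y}$. Let $\Phi=\frac1m\sum_{i=1}^m\phi_i$ with $m\ge 1$, where every $\phi_i:\mathcal M\to\mathbb R$ is differentiable at the points of $\mathcal X$ and $L$-smooth on $\mathcal X$ ($L\ge 0$), i.e. $\|\mathrm{grad}\,\phi_i(y)-\Gamma_x^y\,\mathrm{grad}\,\phi_i(x)\|\le L\,d(x,y)$ for all $x,y\in\mathcal X$. Suppose that $\Phi$ is geodesically convex on $\mathcal X$, i.e. $\Phi(y)\ge\Phi(x)+\langle\mathrm{grad}\,\Phi(x),\mathrm{Exp}_x^{-1}(y)\rangle_x$ for all $x,y\in\mathcal X$, and let $x^*\in\mathcal X$ minimize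 $\Phi$ over $\mathcal X$. Algorithm SVR-RFW with $S\ge1$ epochs of $K\ge1$ iterations, step size $\eta=1/\sqrt{KS}$ and batch size $b=K^2$, started at $\tilde x^0=x_0\in\mathcal X$, is the following. For $s=0,\dots,S-1$ put $x_0^{s+1}=\tilde x^s$; for $k=0,\dots,K-1$ draw a minibatch $I_k^{s+1}=(i_1,\dots,i_b)$ of indices, all indices (within and across minibatches) being independent and uniform on $\{1,\dots,m\}$, form $$g_k=\frac1b\sum_{l=1}^b\Big(\mathrm{grad}\,\phi_{i_l}(x_k^{s+1})-\Gamma_{\tilde x^s}^{x_k^{s+1}}\big(\mathrm{grad}\,\phi_{i_l}(\tilde x^s)-\mathrm{grad}\,\Phi(\tilde x^s)\big)\Big),$$ obtain from the linear optimization oracle (a fixed map that returns a minimizer for each base point in $\mathcal X$ and direction) a point $z_{k+1}^{s+1}\in\arg\min_{z\in\mathcal X}\langle g_k,\mathrm{Exp}^{-1}_{x_k^{s+1}}(z)\rangle$, and set $x_{k+1}^{s+1}=\gamma(\eta)$, where $\gamma=\gamma_{x_k^{s+1},z_{k+1}^{s+1}}$; finally put $\tilde x^{s+1}=x_K^{s+1}$.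 The output is $\hat x=\tilde x^S=x_K^S$. Then there is a constant $C$, depending only on $\mathcal M$, $\mathcal X$, $L$ and an upper bound $\Delta_0$ for the initial optimality gap $\Phi(x_0)-\Phi(x^*)$ (in particular not on $K$, $S$, $m$, nor on the oracle), such that for all $K,S\ge1$ the optimality gap is integrable along the algorithm and $$\mathbb E\big[\Phi(\hat x)-\Phi(x^*)\big]\le\frac{C}{\sqrt{KS}}\qquad\text{and}\qquad\frac1{KS}\sum_{s=0}^{S-1}\sum_{k=0}^{K-1}\mathbb E\big[\Phi(x_k^{s+1})-\Phi(x^*)\big]\le\frac{C}{\sqrt{KS}}.$$ That is, the expected optimality gap is $O(1/\sqrt{KS})$ both for the output $\hat x=x_K^S$ and for an iterate drawn uniformly at random from $\{x_k^{s+1}: 0\le s<S,\ 0\le k<K\}$. -/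

import Mathlib

open Set MeasureTheory ProbabilityTheory Bundle
open scoped Manifold ContDiff Bundle

noncomputable section

namespace SVRRFW

section Geometry

/-! Riemannian geometry of a boundaryless manifold `M` modelled on a finite-dimensional space `E`.
In Mathlib a tangent vector at `p` is represented by its coordinates, an element of `E`, in the
preferred chart at `p`. -/

variable (E : Type*) [NormedAddCommGroup E] [NormedSpace ℝ E]
  {M : Type*} [MetricSpace M] [ChartedSpace E M] [IsManifold 𝓘(ℝ, E) ∞ M]
  [RiemannianBundle (fun x : M => TangentSpace 𝓘(ℝ, E) x)]

/-- The Riemannian inner product of two tangent vectors at `p`. -/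
def metricAt (p : M) (a b : TangentSpace 𝓘(ℝ, E) p) : ℝ := inner ℝ a b

/-- The velocity at time `t` of a curve `γ : [0,1] → M`. -/
def velocity (γ : ℝ → M) (t : ℝ) : TangentSpace 𝓘(ℝ, E) (γ t) :=
  mfderivWithin 𝓘(ℝ, ℝ) 𝓘(ℝ, E) γ (Icc (0 : ℝ) 1) t (1 : ℝ)

/-- The metric tensor read in the preferred chart at `p`: the value `g_u(a, b)` at the point with
coordinates `u`, for the tangent vectors whose components in that chart are `a` and `b`. -/
def chartMetric (p : M) (u a b : E) : ℝ :=
  let q : M := (extChartAt 𝓘(ℝ, E) p).symm u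
  metricAt E q (tangentCoordChange 𝓘(ℝ, E) p q q a) (tangentCoordChange 𝓘(ℝ, E) p q q b)

/-- The Christoffel symbols of the first kind of the Levi-Civita connection in the preferred chart
at `p`, evaluated at `p`:
`g(Γ(v, a), w) = (∂_v g(a, w) + ∂_a g(v, w) - ∂_w g(v, a)) / 2`. -/
def christoffel (p : M) (v a w : E) : ℝ :=
  let u : E := extChartAt 𝓘(ℝ, E) p p
  (1 / 2) * (fderiv ℝ (fun y => chartMetric E p y a w) u v
    + fderiv ℝ (fun y => chartMetric E p y v w) u a
    - fderiv ℝ (fun y => chartMetric E p y v a) u w)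

/-- The vector field `V` along the differentiable curve `γ : [0,1] → M` is parallel for the
Levi-Civita connection: at every time `t`, in the preferred chart at `γ t`, the components of `V`
are differentiable and satisfy `V' + Γ(γ', V) = 0` (tested by the metric against every `w`). -/
def IsParallelAlong (γ : ℝ → M) (V : (t : ℝ) → TangentSpace 𝓘(ℝ, E) (γ t)) : Prop :=
  ∀ t ∈ Icc (0 : ℝ) 1,
    MDifferentiableWithinAt 𝓘(ℝ, ℝ) 𝓘(ℝ, E) γ (Icc (0 : ℝ) 1) t ∧
    ∃ V' : E,
      HasDerivWithinAt
        (fun s => (tangentCoordChange 𝓘(ℝ, E) (γ s) (γ t) (γ s) (V s) : E)) V' (Icc (0 : ℝ) 1) t ∧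
      ∀ w : E,
        metricAt E (γ t) V' w + christoffel E (γ t) (velocity E γ t) (V t) w = 0

/-- `γ : [0,1] → M` is a minimizing geodesic from `x` to `y`: its velocity is parallel along it, and
its length, which is its constant speed, is the Riemannian distance from `x` to `y`. -/
structure IsMinGeodesic (γ : ℝ → M) (x y : M) : Prop where
  source : γ 0 = x
  target : γ 1 = y
  parallel : IsParallelAlong E γ (velocity E γ)
  speed : ‖velocity E γ 0‖ = dist x y

/-- `X` is geodesically convex: any two points of `X` are joined by a unique minimizing geodesic,
and this geodesic stays in `X`. -/
def GeodesicallyConvex (X : Set M) : Prop :=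
  ∀ x ∈ X, ∀ y ∈ X, ∃ γ : ℝ → M, IsMinGeodesic E γ x y ∧ (∀ t ∈ Icc (0 : ℝ) 1, γ t ∈ X) ∧
    ∀ γ' : ℝ → M, IsMinGeodesic E γ' x y → EqOn γ' γ (Icc (0 : ℝ) 1)

open Classical in
/-- The geodesic map: the minimizing geodesic from `x` to `y` (used only where it exists and is
unique on `[0,1]`; elsewhere a junk value). -/
def geodesicMap (x y : M) : ℝ → M :=
  if h : ∃ γ : ℝ → M, IsMinGeodesic E γ x y then h.choose else fun _ => x

/-- The inverse exponential map `Exp_x⁻¹(y)`: the initial velocity of the geodesic from `x` to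
`y`. -/
def expInv (x y : M) : TangentSpace 𝓘(ℝ, E) x :=
  (velocity E (geodesicMap E x y) 0 : E)

open Classical in
/-- Parallel transport `Γ_x^y : T_x M → T_y M` along the geodesic from `x` to `y`: the linear
isometry that sends `V 0` to `V 1` for every parallel vector field `V` along that geodesic. As there
is exactly one parallel field with a given value at time `0`, this determines the map. -/
def transport (x y : M) : TangentSpace 𝓘(ℝ, E) x →ₗ[ℝ] TangentSpace 𝓘(ℝ, E) y :=
  if h : ∃ P : TangentSpace 𝓘(ℝ, E) x →ₗ[ℝ] TangentSpace 𝓘(ℝ, E) y,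
      (∀ a b, inner ℝ (P a) (P b) = inner ℝ a b) ∧
      ∀ V : (t : ℝ) → TangentSpace 𝓘(ℝ, E) (geodesicMap E x y t),
        IsParallelAlong E (geodesicMap E x y) V → P (V 0 : E) = (V 1 : E)
  then h.choose else 0

end Geometry

section Functions

variable (E : Type*) [NormedAddCommGroup E] [NormedSpace ℝ E] [FiniteDimensional ℝ E]
  {M : Type*} [MetricSpace M] [ChartedSpace E M]
  [RiemannianBundle (fun x : M => TangentSpace 𝓘(ℝ, E) x)]

theorem completeSpace_tangentSpace (x : M) : CompleteSpace (TangentSpace 𝓘(ℝ, E) x) :=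
  haveI : FiniteDimensional ℝ (TangentSpace 𝓘(ℝ, E) x) := inferInstanceAs (FiniteDimensional ℝ E)
  FiniteDimensional.complete ℝ (TangentSpace 𝓘(ℝ, E) x)

/-- The Riemannian gradient: the vector representing the differential of `f` at `x`. -/
def rgrad (f : M → ℝ) (x : M) : TangentSpace 𝓘(ℝ, E) x :=
  haveI := completeSpace_tangentSpace E x
  (InnerProductSpace.toDual ℝ (TangentSpace 𝓘(ℝ, E) x)).symm (mfderiv 𝓘(ℝ, E) 𝓘(ℝ, ℝ) f x)

variable [IsManifold 𝓘(ℝ, E) ∞ M]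

/-- `f` is differentiable at the points of `X` and geodesically `L`-smooth on `X`. -/
def LSmoothOn (X : Set M) (L : ℝ) (f : M → ℝ) : Prop :=
  (∀ x ∈ X, MDifferentiableAt 𝓘(ℝ, E) 𝓘(ℝ, ℝ) f x) ∧
  ∀ x ∈ X, ∀ y ∈ X, ‖rgrad E f y - transport E x y (rgrad E f x)‖ ≤ L * dist x y

/-- `f` is geodesically convex on `X`. -/
def GConvexOn (X : Set M) (f : M → ℝ) : Prop :=
  ∀ x ∈ X, ∀ y ∈ X, f x + inner ℝ (rgrad E f x) (expInv E x y) ≤ f y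

/-- `rlo` is a Riemannian linear optimization oracle for `X`: for `x ∈ X` and a direction `g` at
`x`, it returns a minimizer over `z ∈ X` of `⟨g, Exp_x⁻¹(z)⟩`. -/
def IsLinearOracle (X : Set M) (rlo : (x : M) → TangentSpace 𝓘(ℝ, E) x → M) : Prop :=
  ∀ x ∈ X, ∀ g : TangentSpace 𝓘(ℝ, E) x,
    rlo x g ∈ X ∧ ∀ z ∈ X, inner ℝ g (expInv E x (rlo x g)) ≤ inner ℝ g (expInv E x z)

end Functions

section Algorithm

/-- The finite-sum objective `Φ = (1/m) ∑ φ_i`. -/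
def objective {M : Type*} {m : ℕ} (φ : Fin m → M → ℝ) (x : M) : ℝ :=
  (1 / (m : ℝ)) * ∑ i, φ i x

variable (E : Type*) [NormedAddCommGroup E] [NormedSpace ℝ E] [FiniteDimensional ℝ E]
  {M : Type*} [MetricSpace M] [ChartedSpace E M] [IsManifold 𝓘(ℝ, E) ∞ M]
  [RiemannianBundle (fun x : M => TangentSpace 𝓘(ℝ, E) x)] {m b : ℕ}

/-- The variance-reduced gradient estimate at `x` with anchor `xt` and minibatch `I`. -/
def vrGrad (φ : Fin m → M → ℝ) (I : Fin b → Fin m) (xt x : M) : TangentSpace 𝓘(ℝ, E) x :=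
  (1 / (b : ℝ)) • ∑ l, (rgrad E (φ (I l)) x
    - transport E xt x (rgrad E (φ (I l)) xt - rgrad E (objective φ) xt))

/-- The iterates within one epoch, started at the anchor `xt`, with step size `η` and minibatch
`I k` in iteration `k`. -/
def epoch (φ : Fin m → M → ℝ) (rlo : (x : M) → TangentSpace 𝓘(ℝ, E) x → M) (η : ℝ)
    (I : ℕ → Fin b → Fin m) (xt : M) : ℕ → M
  | 0 => xt
  | k + 1 =>
    let x := epoch φ rlo η I xt k
    geodesicMap E x (rlo x (vrGrad E φ (I k) xt x)) η

/-- The anchor points: `anchor 0 = x0`, and `anchor (s + 1)` is the point reached after the `K`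
iterations of the epoch started at `anchor s`. The algorithm with `S` epochs outputs `anchor S`. -/
def anchor (φ : Fin m → M → ℝ) (rlo : (x : M) → TangentSpace 𝓘(ℝ, E) x → M) (η : ℝ) (K : ℕ)
    (I : ℕ → ℕ → Fin b → Fin m) (x0 : M) : ℕ → M
  | 0 => x0
  | s + 1 => epoch E φ rlo η (I s) (anchor φ rlo η K I x0 s) K

/-- The iterate `x_k^{s+1}`, i.e. the `k`-th iterate of the epoch started at `anchor s`. -/
def iterate (φ : Fin m → M → ℝ) (rlo : (x : M) → TangentSpace 𝓘(ℝ, E) x → M) (η : ℝ) (K : ℕ)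
    (I : ℕ → ℕ → Fin b → Fin m) (x0 : M) (s k : ℕ) : M :=
  epoch E φ rlo η (I s) (anchor E φ rlo η K I x0 s) k

end Algorithm

/-- The indices `i s k l` (for epoch `s < S`, iteration `k < K`, position `l < b` in the minibatch)
are independent and uniformly distributed on `Fin m`. -/
structure IsUniformSampling {Ω : Type*} [MeasurableSpace Ω] (μ : Measure Ω) (m b K S : ℕ)
    (i : ℕ → ℕ → Fin b → Ω → Fin m) : Prop where
  measurable : ∀ s k l, Measurable (i s k l)
  indep : iIndepFun (fun p : Fin S × Fin K × Fin b => i p.1 p.2.1 p.2.2) μ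
  uniform : ∀ s < S, ∀ k < K, ∀ l, ∀ j : Fin m, μ (i s k l ⁻¹' {j}) = ((m : ENNReal))⁻¹

end SVRRFW

end

/-! Let `D` bound the diameter of `X`. Moving a fraction `η` towards the oracle's point decreases
`Φ` by the descent lemma (`LSmoothOn.le_of_geodesicMap`). Minimality for the estimate `g`, compared
with the minimizer, and geodesic convexity turn this into gap ↦ `(1 - η)` gap `+ 2Dη‖g - grad Φ‖ +
LD²η²/2` (`IsLinearOracle.step_le`).

Variance reduction makes the middle term quadratic in `η` as well. Within an epoch the iterate stays
within `KηD` of its anchor, so each difference of a gradient and its transported anchor value has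
norm at most `LKηD`. A minibatch of `K²` independent samples divides the deviation by `K`, leaving
an expected error of at most `LDη` (`integral_norm_vrGrad_sub_le`). The expected gaps thus satisfy
`e' ≤ (1 - η)e + cη²` with `c = (5/2)LD²`. Unrolling bounds the last gap by `(1 - η)^(KS) Δ₀ + cη`,
telescoping bounds the average, and `η = 1/√(KS)` gives both rates.

Of parallel transport only three properties are needed: linearity, isometry, and that it carries the
velocity of a geodesic to its velocity. They follow from metric compatibility of the connection
(`IsParallelAlong.metricAt_eq`, `transport_spec`), with no existence theorem for the parallel
transport equation. The oracle need not be measurable, because every random quantity factors through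
finitely many indices. -/

namespace SVRRFW

/-! ### The metric tensor in charts. -/

section Geometry

open Filter Topology

variable {E : Type*} [NormedAddCommGroup E] [NormedSpace ℝ E]
  {M : Type*} [MetricSpace M] [ChartedSpace E M]
  [RiemannianBundle (fun x : M => TangentSpace 𝓘(ℝ, E) x)]

theorem metricAt_add_left (p : M) (a b c : E) :
    metricAt E p (a + b : E) c = metricAt E p a c + metricAt E p b c :=
  inner_add_left (𝕜 := ℝ) (E := TangentSpace 𝓘(ℝ, E) p) a b c

theorem metricAt_smul_left (p : M) (r : ℝ) (a b : E) :
    metricAt E p (r • a : E) b = r * metricAt E p a b :=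
  real_inner_smul_left (F := TangentSpace 𝓘(ℝ, E) p) a b r

theorem metricAt_comm (p : M) (a b : E) : metricAt E p a b = metricAt E p b a :=
  real_inner_comm (F := TangentSpace 𝓘(ℝ, E) p) b a

theorem metricAt_add_right (p : M) (a b c : E) :
    metricAt E p a (b + c : E) = metricAt E p a b + metricAt E p a c :=
  inner_add_right (𝕜 := ℝ) (E := TangentSpace 𝓘(ℝ, E) p) a b c

theorem metricAt_smul_right (p : M) (r : ℝ) (a b : E) :
    metricAt E p a (r • b : E) = r * metricAt E p a b :=
  real_inner_smul_right (F := TangentSpace 𝓘(ℝ, E) p) a b r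

theorem metricAt_self (p : M) (a : TangentSpace 𝓘(ℝ, E) p) : metricAt E p a a = ‖a‖ ^ 2 :=
  real_inner_self_eq_norm_sq a

variable [IsManifold 𝓘(ℝ, E) ∞ M]

theorem chartMetric_add_left (p : M) (u a b c : E) :
    chartMetric E p u (a + b) c = chartMetric E p u a c + chartMetric E p u b c := by
  simp only [chartMetric, map_add, metricAt_add_left]

theorem chartMetric_smul_left (p : M) (r : ℝ) (u a b : E) :
    chartMetric E p u (r • a) b = r * chartMetric E p u a b := by
  simp only [chartMetric, map_smul, metricAt_smul_left]

theorem chartMetric_comm (p : M) (u a b : E) :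
    chartMetric E p u a b = chartMetric E p u b a :=
  metricAt_comm _ _ _

theorem chartMetric_add_right (p : M) (u a b c : E) :
    chartMetric E p u a (b + c) = chartMetric E p u a b + chartMetric E p u a c := by
  simp only [chartMetric, map_add, metricAt_add_right]

theorem chartMetric_smul_right (p : M) (r : ℝ) (u a b : E) :
    chartMetric E p u a (r • b) = r * chartMetric E p u a b := by
  simp only [chartMetric, map_smul, metricAt_smul_right]

theorem chartMetric_self (p : M) (a b : E) :
    chartMetric E p (extChartAt 𝓘(ℝ, E) p p) a b = metricAt E p a b := by
  have h : ∀ q : M, q = p → metricAt E q (tangentCoordChange 𝓘(ℝ, E) p q q a)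
      (tangentCoordChange 𝓘(ℝ, E) p q q b) = metricAt E p a b := by
    rintro q rfl
    rw [tangentCoordChange_self (mem_extChartAt_source q),
      tangentCoordChange_self (mem_extChartAt_source q)]
  exact h _ (extChartAt_to_inv p)

/-- The inner product of two tangent vectors at `q`, computed in the chart at `p`. -/
theorem chartMetric_tangentCoordChange {p q : M} (hq : q ∈ (extChartAt 𝓘(ℝ, E) p).source)
    (a b : E) :
    chartMetric E p (extChartAt 𝓘(ℝ, E) p q) (tangentCoordChange 𝓘(ℝ, E) q p q a)
      (tangentCoordChange 𝓘(ℝ, E) q p q b) = metricAt E q a b := by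
  have h : ∀ q' : M, q' = q → metricAt E q'
      (tangentCoordChange 𝓘(ℝ, E) p q' q' (tangentCoordChange 𝓘(ℝ, E) q p q a))
      (tangentCoordChange 𝓘(ℝ, E) p q' q' (tangentCoordChange 𝓘(ℝ, E) q p q b))
        = metricAt E q a b := by
    rintro q' rfl
    have hs := mem_extChartAt_source (I := 𝓘(ℝ, E)) q'
    rw [tangentCoordChange_comp ⟨⟨hs, hq⟩, hs⟩, tangentCoordChange_comp ⟨⟨hs, hq⟩, hs⟩,
      tangentCoordChange_self hs, tangentCoordChange_self hs]
  exact h _ ((extChartAt 𝓘(ℝ, E) p).left_inv hq)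

variable [IsContMDiffRiemannianBundle 𝓘(ℝ, E) ∞ E (fun x : M => TangentSpace 𝓘(ℝ, E) x)]

/-- Vectors with constant components in the chart at `p` form smooth sections along the inverse
chart, and the bundle metric of two such sections is `C^1`. -/
theorem differentiableAt_chartMetric (p : M) (a b : E) :
    DifferentiableAt ℝ (fun y => chartMetric E p y a b) (extChartAt 𝓘(ℝ, E) p p) := by
  have hsec : ∀ c : E, ContMDiffAt 𝓘(ℝ, E) (𝓘(ℝ, E).prod 𝓘(ℝ, E)) 1
      (fun y : E => (⟨(extChartAt 𝓘(ℝ, E) p).symm y,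
        tangentCoordChange 𝓘(ℝ, E) p ((extChartAt 𝓘(ℝ, E) p).symm y)
          ((extChartAt 𝓘(ℝ, E) p).symm y) c⟩ : TotalSpace E (fun x : M => TangentSpace 𝓘(ℝ, E) x)))
      (extChartAt 𝓘(ℝ, E) p p) := by
    intro c
    rw [contMDiffAt_totalSpace]
    constructor
    · exact ((contMDiffOn_extChartAt_symm p).contMDiffAt (extChartAt_target_mem_nhds p))
    · refine (contMDiffAt_const (c := c)).congr_of_eventuallyEq ?_
      filter_upwards [extChartAt_target_mem_nhds (I := 𝓘(ℝ, E)) p] with y hy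
      have hq := (extChartAt 𝓘(ℝ, E) p).map_target hy
      have hs := mem_extChartAt_source (I := 𝓘(ℝ, E)) ((extChartAt 𝓘(ℝ, E) p).symm y)
      have := tangentCoordChange_comp (I := 𝓘(ℝ, E)) (v := c) ⟨⟨hq, hs⟩, hq⟩
      rw [tangentCoordChange_self hq] at this
      rw [extChartAt_to_inv]
      exact this
  let v : ∀ c y : E, TangentSpace 𝓘(ℝ, E) ((extChartAt 𝓘(ℝ, E) p).symm y) := fun c y =>
    tangentCoordChange 𝓘(ℝ, E) p ((extChartAt 𝓘(ℝ, E) p).symm y)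
      ((extChartAt 𝓘(ℝ, E) p).symm y) c
  have h : ContMDiffAt 𝓘(ℝ, E) 𝓘(ℝ, ℝ) 1 (fun y => inner ℝ (v a y) (v b y))
      (extChartAt 𝓘(ℝ, E) p p) := by
    apply ContMDiffAt.inner_bundle (IB := 𝓘(ℝ, E)) (F := E)
    · exact hsec a
    · exact hsec b
  exact h.contDiffAt.differentiableAt one_ne_zero

end Geometry

/-- Serves to differentiate a varying bilinear form along varying arguments when only its values on
fixed vectors are known to be differentiable. -/
theorem bilin_eq_sum_basis {E ι : Type*} [Fintype ι] [AddCommGroup E] [Module ℝ E]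
    (e : Module.Basis ι ℝ E) (B : E →ₗ[ℝ] E →ₗ[ℝ] ℝ) (x y : E) :
    B x y = ∑ i, ∑ j, e.coord i x * e.coord j y * B (e i) (e j) := by
  conv_lhs => rw [← e.sum_repr x, ← e.sum_repr y]
  simp only [map_sum, map_smul, LinearMap.sum_apply, LinearMap.smul_apply, smul_eq_mul,
    Module.Basis.coord_apply, Finset.mul_sum]
  rw [Finset.sum_comm]
  exact Finset.sum_congr rfl fun i _ => Finset.sum_congr rfl fun j _ => by ring

/-! ### The Levi-Civita connection and parallel fields. -/

section Geometry

open Filter Topology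

variable {E : Type*} [NormedAddCommGroup E] [NormedSpace ℝ E]
  {M : Type*} [MetricSpace M] [ChartedSpace E M]
  [RiemannianBundle (fun x : M => TangentSpace 𝓘(ℝ, E) x)]
  [IsManifold 𝓘(ℝ, E) ∞ M]
  [IsContMDiffRiemannianBundle 𝓘(ℝ, E) ∞ E (fun x : M => TangentSpace 𝓘(ℝ, E) x)]

theorem fderiv_chartMetric_add_left (p : M) (a b c : E) :
    fderiv ℝ (fun y => chartMetric E p y (a + b) c) (extChartAt 𝓘(ℝ, E) p p) =
      fderiv ℝ (fun y => chartMetric E p y a c) (extChartAt 𝓘(ℝ, E) p p) +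
      fderiv ℝ (fun y => chartMetric E p y b c) (extChartAt 𝓘(ℝ, E) p p) := by
  simp only [chartMetric_add_left]
  exact fderiv_fun_add (differentiableAt_chartMetric p a c) (differentiableAt_chartMetric p b c)

theorem fderiv_chartMetric_smul_left (p : M) (r : ℝ) (a b : E) :
    fderiv ℝ (fun y => chartMetric E p y (r • a) b) (extChartAt 𝓘(ℝ, E) p p) =
      r • fderiv ℝ (fun y => chartMetric E p y a b) (extChartAt 𝓘(ℝ, E) p p) := by
  simp only [chartMetric_smul_left]
  exact fderiv_const_mul (differentiableAt_chartMetric p a b) r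

theorem fderiv_chartMetric_add_right (p : M) (a b c : E) :
    fderiv ℝ (fun y => chartMetric E p y a (b + c)) (extChartAt 𝓘(ℝ, E) p p) =
      fderiv ℝ (fun y => chartMetric E p y a b) (extChartAt 𝓘(ℝ, E) p p) +
      fderiv ℝ (fun y => chartMetric E p y a c) (extChartAt 𝓘(ℝ, E) p p) := by
  simp only [fun y b => chartMetric_comm p y a b]
  exact fderiv_chartMetric_add_left p b c a

theorem fderiv_chartMetric_smul_right (p : M) (r : ℝ) (a b : E) :
    fderiv ℝ (fun y => chartMetric E p y a (r • b)) (extChartAt 𝓘(ℝ, E) p p) =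
      r • fderiv ℝ (fun y => chartMetric E p y a b) (extChartAt 𝓘(ℝ, E) p p) := by
  simp only [fun y b => chartMetric_comm p y a b]
  exact fderiv_chartMetric_smul_left p r b a

theorem christoffel_add_right (p : M) (v a b w : E) :
    christoffel E p v (a + b) w = christoffel E p v a w + christoffel E p v b w := by
  simp only [christoffel, fderiv_chartMetric_add_left, fderiv_chartMetric_add_right, map_add,
    add_apply]
  ring

theorem christoffel_smul_right (p : M) (r : ℝ) (v a w : E) :
    christoffel E p v (r • a) w = r * christoffel E p v a w := by
  simp only [christoffel, fderiv_chartMetric_smul_left, fderiv_chartMetric_smul_right, map_smul,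
    smul_apply, smul_eq_mul]
  ring

theorem christoffel_smul_left (p : M) (r : ℝ) (v a w : E) :
    christoffel E p (r • v) a w = r * christoffel E p v a w := by
  simp only [christoffel, fderiv_chartMetric_smul_left, map_smul,
    smul_apply, smul_eq_mul]
  ring

omit [IsContMDiffRiemannianBundle 𝓘(ℝ, E) ∞ E (fun x : M => TangentSpace 𝓘(ℝ, E) x)] in
/-- The Levi-Civita connection is compatible with the metric. -/
theorem christoffel_add_christoffel (p : M) (v a b : E) :
    christoffel E p v a b + christoffel E p v b a =
      fderiv ℝ (fun y => chartMetric E p y a b) (extChartAt 𝓘(ℝ, E) p p) v := by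
  simp only [christoffel, chartMetric_comm p _ b a]
  ring

/-- Leibniz rule, applied to each term of the expansion in a basis. The differentiability of the
metric is used only at the centre of the chart, hence `hut`. -/
theorem hasDerivWithinAt_chartMetric [FiniteDimensional ℝ E] (p : M) {s : Set ℝ} {t : ℝ}
    {u a b : ℝ → E} {u' a' b' : E} (hu : HasDerivWithinAt u u' s t)
    (ha : HasDerivWithinAt a a' s t) (hb : HasDerivWithinAt b b' s t)
    (hut : u t = extChartAt 𝓘(ℝ, E) p p) :
    HasDerivWithinAt (fun r => chartMetric E p (u r) (a r) (b r))
      (metricAt E p a' (b t) + metricAt E p (a t) b' +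
        fderiv ℝ (fun y => chartMetric E p y (a t) (b t)) (extChartAt 𝓘(ℝ, E) p p) u') s t := by
  let e := Module.finBasis ℝ E
  let G : E → E →ₗ[ℝ] E →ₗ[ℝ] ℝ := fun y => LinearMap.mk₂ ℝ (chartMetric E p y)
    (fun a b c => chartMetric_add_left p y a b c) (fun r a b => chartMetric_smul_left p r y a b)
    (fun a b c => chartMetric_add_right p y a b c) (fun r a b => chartMetric_smul_right p r y a b)
  let D : E →ₗ[ℝ] E →ₗ[ℝ] ℝ := LinearMap.mk₂ ℝ
    (fun a b => fderiv ℝ (fun y => chartMetric E p y a b) (extChartAt 𝓘(ℝ, E) p p) u')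
    (fun a b c => by simp only [fderiv_chartMetric_add_left, add_apply])
    (fun r a b => by simp only [fderiv_chartMetric_smul_left, smul_apply])
    (fun a b c => by simp only [fderiv_chartMetric_add_right, add_apply])
    (fun r a b => by simp only [fderiv_chartMetric_smul_right, smul_apply])
  have hcoord : ∀ (i) {c : ℝ → E} {c' : E}, HasDerivWithinAt c c' s t →
      HasDerivWithinAt (fun r => e.coord i (c r)) (e.coord i c') s t := fun i c c' hc =>
    (LinearMap.toContinuousLinearMap (e.coord i)).hasFDerivAt.comp_hasDerivWithinAt t hc
  have hG : ∀ i j, HasDerivWithinAt (fun r => G (u r) (e i) (e j)) (D (e i) (e j)) s t :=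
    fun i j => (hut ▸ (differentiableAt_chartMetric p (e i) (e j)).hasFDerivAt :
      HasFDerivAt (fun y => chartMetric E p y (e i) (e j)) _ (u t)).comp_hasDerivWithinAt t hu
  have key : HasDerivWithinAt (fun r => G (u r) (a r) (b r))
      (G (u t) a' (b t) + G (u t) (a t) b' + D (a t) (b t)) s t := by
    rw [funext fun r => bilin_eq_sum_basis e (G (u r)) (a r) (b r)]
    rw [bilin_eq_sum_basis e (G (u t)) a' (b t), bilin_eq_sum_basis e (G (u t)) (a t) b',
      bilin_eq_sum_basis e D (a t) (b t)]
    simp only [← Finset.sum_add_distrib]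
    refine HasDerivWithinAt.fun_sum fun i _ => HasDerivWithinAt.fun_sum fun j _ => ?_
    refine (((hcoord i ha).fun_mul (hcoord j hb)).mul (hG i j)).congr_deriv ?_
    ring
  refine key.congr_deriv ?_
  simp only [G, D, LinearMap.mk₂_apply, hut, chartMetric_self]

omit [RiemannianBundle (fun x : M => TangentSpace 𝓘(ℝ, E) x)]
  [IsContMDiffRiemannianBundle 𝓘(ℝ, E) ∞ E (fun x : M => TangentSpace 𝓘(ℝ, E) x)] in
theorem hasDerivWithinAt_extChartAt_comp {γ : ℝ → M} {t : ℝ} (p : M)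
    (hγ : MDifferentiableWithinAt 𝓘(ℝ, ℝ) 𝓘(ℝ, E) γ (Icc (0 : ℝ) 1) t)
    (hp : γ t ∈ (extChartAt 𝓘(ℝ, E) p).source) :
    HasDerivWithinAt (fun s => extChartAt 𝓘(ℝ, E) p (γ s))
      (tangentCoordChange 𝓘(ℝ, E) (γ t) p (γ t) (velocity E γ t) : E) (Icc (0 : ℝ) 1) t := by
  have hp' : γ t ∈ (chartAt E p).source := by rwa [extChartAt_source] at hp
  have h := (hasMFDerivAt_extChartAt (I := 𝓘(ℝ, E)) hp').comp_hasMFDerivWithinAt t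
    hγ.hasMFDerivWithinAt
  rw [mfderiv_chartAt_eq_tangentCoordChange hp'] at h
  have h' : HasFDerivWithinAt (fun s => extChartAt 𝓘(ℝ, E) p (γ s))
      ((tangentCoordChange 𝓘(ℝ, E) (γ t) p (γ t)).comp
        (show ℝ →L[ℝ] E from mfderivWithin 𝓘(ℝ, ℝ) 𝓘(ℝ, E) γ (Icc (0 : ℝ) 1) t))
      (Icc (0 : ℝ) 1) t := hasMFDerivWithinAt_iff_hasFDerivWithinAt.mp h
  exact h'.hasDerivWithinAt

/-- In the chart at `γ t`, the Leibniz rule yields `g(V', W) + g(V, W')` plus the derivative of the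
metric along the velocity. The two parallel equations replace the first terms by Christoffel
symbols, and metric compatibility cancels the rest. -/
theorem IsParallelAlong.hasDerivWithinAt_metricAt [FiniteDimensional ℝ E] {γ : ℝ → M}
    {V W : (t : ℝ) → TangentSpace 𝓘(ℝ, E) (γ t)} (hV : IsParallelAlong E γ V)
    (hW : IsParallelAlong E γ W) {t : ℝ} (ht : t ∈ Icc (0 : ℝ) 1) :
    HasDerivWithinAt (fun s => metricAt E (γ s) (V s) (W s)) 0 (Icc (0 : ℝ) 1) t := by
  obtain ⟨hγ, V', hV', hVw⟩ := hV t ht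
  obtain ⟨-, W', hW', hWw⟩ := hW t ht
  have hs := mem_extChartAt_source (I := 𝓘(ℝ, E)) (γ t)
  have hu := hasDerivWithinAt_extChartAt_comp (γ t) hγ hs
  have e : ∀ v : E, tangentCoordChange 𝓘(ℝ, E) (γ t) (γ t) (γ t) v = v :=
    fun v => tangentCoordChange_self hs
  have h := hasDerivWithinAt_chartMetric (γ t) hu hV' hW' rfl
  have key : ∀ v a b : E, v = velocity E γ t → a = V t → b = W t →
      metricAt E (γ t) V' b + metricAt E (γ t) a W' + fderiv ℝ
        (fun y => chartMetric E (γ t) y a b) (extChartAt 𝓘(ℝ, E) (γ t) (γ t)) v = 0 := by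
    rintro v a b rfl rfl rfl
    have h1 := christoffel_add_christoffel (E := E) (γ t) (velocity E γ t) (V t) (W t)
    linarith [hVw (W t), hWw (V t), metricAt_comm (E := E) (γ t) (V t) W']
  refine (h.congr_of_eventuallyEq ?_ ?_).congr_deriv ?_
  · filter_upwards [hγ.continuousWithinAt.preimage_mem_nhdsWithin
      (extChartAt_source_mem_nhds (I := 𝓘(ℝ, E)) (γ t))] with s hs
    exact (chartMetric_tangentCoordChange hs _ _).symm
  · exact (chartMetric_tangentCoordChange hs _ _).symm
  · exact key _ _ _ (e _) (e _) (e _)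

/-- Parallel transport preserves the metric. -/
theorem IsParallelAlong.metricAt_eq [FiniteDimensional ℝ E] {γ : ℝ → M}
    {V W : (t : ℝ) → TangentSpace 𝓘(ℝ, E) (γ t)} (hV : IsParallelAlong E γ V)
    (hW : IsParallelAlong E γ W) {t : ℝ} (ht : t ∈ Icc (0 : ℝ) 1) :
    metricAt E (γ t) (V t) (W t) = metricAt E (γ 0) (V 0) (W 0) := by
  refine constant_of_derivWithin_zero (fun s hs =>
    (hV.hasDerivWithinAt_metricAt hW hs).differentiableWithinAt) (fun s hs => ?_) t ht
  exact (hV.hasDerivWithinAt_metricAt hW (Ico_subset_Icc_self hs)).derivWithin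
    (uniqueDiffOn_Icc zero_lt_one s (Ico_subset_Icc_self hs))

theorem IsParallelAlong.add [FiniteDimensional ℝ E] {γ : ℝ → M}
    {V W : (t : ℝ) → TangentSpace 𝓘(ℝ, E) (γ t)} (hV : IsParallelAlong E γ V)
    (hW : IsParallelAlong E γ W) : IsParallelAlong E γ (V + W) := by
  intro t ht
  obtain ⟨hγ, V', hV', hVw⟩ := hV t ht
  obtain ⟨-, W', hW', hWw⟩ := hW t ht
  refine ⟨hγ, V' + W', ?_, fun w => ?_⟩
  · refine (hV'.fun_add hW').congr_of_mem (fun s _ => ?_) ht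
    exact map_add (tangentCoordChange 𝓘(ℝ, E) (γ s) (γ t) (γ s)) (V s : E) (W s : E)
  · have h1 := metricAt_add_left (γ t) V' W' w
    have h2 := christoffel_add_right (E := E) (γ t) (velocity E γ t) (V t) (W t) w
    have h3 : christoffel E (γ t) (velocity E γ t) ((V + W) t) w =
      christoffel E (γ t) (velocity E γ t) (V t) w +
      christoffel E (γ t) (velocity E γ t) (W t) w := h2
    linarith [hVw w, hWw w]

theorem IsParallelAlong.smul [FiniteDimensional ℝ E] {γ : ℝ → M}
    {V : (t : ℝ) → TangentSpace 𝓘(ℝ, E) (γ t)} (hV : IsParallelAlong E γ V) (r : ℝ) :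
    IsParallelAlong E γ (r • V) := by
  intro t ht
  obtain ⟨hγ, V', hV', hVw⟩ := hV t ht
  refine ⟨hγ, r • V', ?_, fun w => ?_⟩
  · refine (hV'.fun_const_smul r).congr_of_mem (fun s _ => ?_) ht
    exact map_smul (tangentCoordChange 𝓘(ℝ, E) (γ s) (γ t) (γ s)) r (V s : E)
  · have h1 := metricAt_smul_left (γ t) r V' w
    have h2 : christoffel E (γ t) (velocity E γ t) ((r • V) t) w =
      r * christoffel E (γ t) (velocity E γ t) (V t) w :=
      christoffel_smul_right (E := E) (γ t) r (velocity E γ t) (V t) w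
    rw [h1, h2, ← mul_add, hVw w, mul_zero]

end Geometry

/-- Equality of norms forces the kernel of `f` into that of `g`, so `g` descends to an isometry on
the range of `f`, which then extends to all of `F`. -/
theorem exists_linearIsometry_comp_eq {V F G : Type*} [AddCommGroup V] [Module ℝ V]
    [NormedAddCommGroup F] [InnerProductSpace ℝ F] [FiniteDimensional ℝ F]
    [NormedAddCommGroup G] [InnerProductSpace ℝ G] [FiniteDimensional ℝ G]
    (hFG : Module.finrank ℝ F = Module.finrank ℝ G) (f : V →ₗ[ℝ] F) (g : V →ₗ[ℝ] G)
    (hfg : ∀ v, ‖g v‖ = ‖f v‖) : ∃ P : F →ₗᵢ[ℝ] G, ∀ v, P (f v) = g v := by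
  obtain ⟨r, hr⟩ := f.rangeRestrict.exists_rightInverse_of_surjective f.range_rangeRestrict
  have hr' : ∀ y : LinearMap.range f, f (r y) = y := fun y =>
    congrArg Subtype.val (LinearMap.congr_fun hr y)
  -- `LinearIsometry.extend` extends maps from a subspace into its own ambient space, so `G` is
  -- identified with `F` first.
  let e : G ≃ₗᵢ[ℝ] F := (stdOrthonormalBasis ℝ G).equiv (stdOrthonormalBasis ℝ F)
    (finCongr hFG.symm)
  let L : LinearMap.range f →ₗᵢ[ℝ] F :=
    { toLinearMap := e.toLinearEquiv.toLinearMap ∘ₗ g ∘ₗ r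
      norm_map' := fun y => by
        change ‖e (g (r y))‖ = ‖y‖
        rw [e.norm_map, hfg, hr', Submodule.coe_norm] }
  refine ⟨e.symm.toLinearIsometry.comp L.extend, fun v => ?_⟩
  have h1 : L.extend (f v) = L ⟨f v, LinearMap.mem_range_self f v⟩ := L.extend_apply ⟨f v, _⟩
  change e.symm (L.extend (f v)) = g v
  rw [h1]
  change e.symm (e (g (r _))) = g v
  rw [e.symm_apply_apply, ← sub_eq_zero, ← map_sub, ← norm_eq_zero, hfg, map_sub, hr', sub_self,
    norm_zero]

/-! ### Parallel transport and segments of minimizing geodesics. -/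

section Geometry

open Filter Topology

variable {E : Type*} [NormedAddCommGroup E] [NormedSpace ℝ E]
  {M : Type*} [MetricSpace M] [ChartedSpace E M]

theorem velocity_comp_mul {γ : ℝ → M} {t s : ℝ} (ht : t ∈ Icc (0 : ℝ) 1) (hs : s ∈ Icc (0 : ℝ) 1)
    (hγ : MDifferentiableWithinAt 𝓘(ℝ, ℝ) 𝓘(ℝ, E) γ (Icc (0 : ℝ) 1) (t * s)) :
    MDifferentiableWithinAt 𝓘(ℝ, ℝ) 𝓘(ℝ, E) (fun r => γ (t * r)) (Icc (0 : ℝ) 1) s ∧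
    (velocity E (fun r => γ (t * r)) s : E) = t • (velocity E γ (t * s) : E) := by
  have hmap : MapsTo (fun r => t * r) (Icc (0 : ℝ) 1) (Icc (0 : ℝ) 1) := fun r hr =>
    ⟨mul_nonneg ht.1 hr.1, mul_le_one₀ ht.2 hr.1 hr.2⟩
  have h1 : HasMFDerivWithinAt 𝓘(ℝ, ℝ) 𝓘(ℝ, ℝ) (fun r => t * r) (Icc (0 : ℝ) 1) s
      (t • ContinuousLinearMap.id ℝ ℝ) :=
    ((hasFDerivAt_id s).const_mul t).hasFDerivWithinAt.hasMFDerivWithinAt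
  have h2 := HasMFDerivWithinAt.comp s hγ.hasMFDerivWithinAt h1 hmap
  refine ⟨h2.mdifferentiableWithinAt, ?_⟩
  have h3 := h2.mfderivWithin ((uniqueDiffOn_Icc zero_lt_one s hs).uniqueMDiffWithinAt)
  have h4 := congrArg (fun A : ℝ →L[ℝ] E => A 1) h3
  refine h4.trans ?_
  have h5 := map_smul (show ℝ →L[ℝ] E from mfderivWithin 𝓘(ℝ, ℝ) 𝓘(ℝ, E) γ (Icc (0 : ℝ) 1) (t * s))
    t (1 : ℝ)
  exact h5

theorem velocity_congr {γ γ' : ℝ → M} (h : EqOn γ γ' (Icc (0 : ℝ) 1)) {t : ℝ}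
    (ht : t ∈ Icc (0 : ℝ) 1) : (velocity E γ t : E) = (velocity E γ' t : E) := by
  have h1 := mfderivWithin_congr (I := 𝓘(ℝ, ℝ)) (I' := 𝓘(ℝ, E)) (fun s hs => h hs) (h ht)
  exact congrArg (fun A : ℝ →L[ℝ] E => A 1) h1

variable [RiemannianBundle (fun x : M => TangentSpace 𝓘(ℝ, E) x)]

theorem metricAt_congr {p q : M} (h : p = q) (a b : E) : metricAt E p a b = metricAt E q a b := by
  rw [h]

variable [IsManifold 𝓘(ℝ, E) ∞ M]
  [IsContMDiffRiemannianBundle 𝓘(ℝ, E) ∞ E (fun x : M => TangentSpace 𝓘(ℝ, E) x)]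

/-- The parallel vector fields along a curve that carries at least one of them. -/
def parallelFields [FiniteDimensional ℝ E] (γ : ℝ → M)
    {W : (t : ℝ) → TangentSpace 𝓘(ℝ, E) (γ t)} (hW : IsParallelAlong E γ W) :
    Submodule ℝ ((t : ℝ) → TangentSpace 𝓘(ℝ, E) (γ t)) where
  carrier := {V | IsParallelAlong E γ V}
  add_mem' := fun hV hV' => IsParallelAlong.add hV hV'
  zero_mem' := by simpa using hW.smul 0
  smul_mem' := fun r _ hV => IsParallelAlong.smul hV r

/-- Shows that `transport` does not take its default value. The endpoint values of parallel fields
are related isometrically, and this partial isometry extends to the whole tangent space whether or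
not the initial values fill it. -/
theorem transport_spec [FiniteDimensional ℝ E] {x y : M}
    (h : IsMinGeodesic E (geodesicMap E x y) x y) :
    (∀ a b, inner ℝ (transport E x y a) (transport E x y b) = inner ℝ a b) ∧
    ∀ V : (t : ℝ) → TangentSpace 𝓘(ℝ, E) (geodesicMap E x y t),
      IsParallelAlong E (geodesicMap E x y) V → transport E x y (V 0 : E) = (V 1 : E) := by
  have hex : ∃ P : TangentSpace 𝓘(ℝ, E) x →ₗ[ℝ] TangentSpace 𝓘(ℝ, E) y,
      (∀ a b, inner ℝ (P a) (P b) = inner ℝ a b) ∧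
      ∀ V : (t : ℝ) → TangentSpace 𝓘(ℝ, E) (geodesicMap E x y t),
        IsParallelAlong E (geodesicMap E x y) V → P (V 0 : E) = (V 1 : E) := by
    have : FiniteDimensional ℝ (TangentSpace 𝓘(ℝ, E) x) := inferInstanceAs (FiniteDimensional ℝ E)
    have : FiniteDimensional ℝ (TangentSpace 𝓘(ℝ, E) y) := inferInstanceAs (FiniteDimensional ℝ E)
    let f : parallelFields (geodesicMap E x y) h.parallel →ₗ[ℝ] TangentSpace 𝓘(ℝ, E) x :=
      { toFun := fun V => (V.1 0 : E), map_add' := fun _ _ => rfl, map_smul' := fun _ _ => rfl }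
    let g : parallelFields (geodesicMap E x y) h.parallel →ₗ[ℝ] TangentSpace 𝓘(ℝ, E) y :=
      { toFun := fun V => (V.1 1 : E), map_add' := fun _ _ => rfl, map_smul' := fun _ _ => rfl }
    obtain ⟨P, hP⟩ := exists_linearIsometry_comp_eq (F := TangentSpace 𝓘(ℝ, E) x)
      (G := TangentSpace 𝓘(ℝ, E) y) rfl f g (fun V => by
        have h1 : metricAt E y (g V) (g V) = metricAt E x (f V) (f V) :=
          (metricAt_congr h.target.symm _ _).trans
            ((IsParallelAlong.metricAt_eq V.2 V.2 (right_mem_Icc.2 zero_le_one)).trans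
              (metricAt_congr h.source _ _))
        rw [metricAt_self, metricAt_self] at h1
        exact (sq_eq_sq₀ (norm_nonneg _) (norm_nonneg _)).1 h1)
    exact ⟨P.toLinearMap, P.inner_map_map, fun V hV => hP ⟨V, hV⟩⟩
  rw [transport, dif_pos hex]
  exact hex.choose_spec

theorem IsParallelAlong.velocity_comp_mul [FiniteDimensional ℝ E] {γ : ℝ → M}
    (hγ : IsParallelAlong E γ (velocity E γ))
    {t : ℝ} (ht : t ∈ Icc (0 : ℝ) 1) :
    IsParallelAlong E (fun r => γ (t * r)) (velocity E (fun r => γ (t * r))) := by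
  have hmap : MapsTo (fun r => t * r) (Icc (0 : ℝ) 1) (Icc (0 : ℝ) 1) := fun r hr =>
    ⟨mul_nonneg ht.1 hr.1, mul_le_one₀ ht.2 hr.1 hr.2⟩
  intro s hs
  have hvel : ∀ r ∈ Icc (0 : ℝ) 1, (velocity E (fun r => γ (t * r)) r : E) =
      t • (velocity E γ (t * r) : E) := fun r hr =>
    (SVRRFW.velocity_comp_mul ht hr (hγ _ (hmap hr)).1).2
  obtain ⟨hd, V', hV', hVw⟩ := hγ (t * s) (hmap hs)
  -- One factor `t` comes from the rescaled velocity, one from the chain rule. The Christoffel term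
  -- is quadratic in the velocity, so it scales by the same `t * t`.
  refine ⟨(SVRRFW.velocity_comp_mul ht hs hd).1, t • t • V', ?_, fun w => ?_⟩
  · have h1 : HasDerivWithinAt (fun r => t * r) t (Icc (0 : ℝ) 1) s := by
      simpa using ((hasDerivAt_id s).const_mul t).hasDerivWithinAt
    have h2 := (hV'.scomp s h1 hmap).fun_const_smul t
    refine h2.congr_of_mem (fun r hr => ?_) hs
    have h3 := map_smul (tangentCoordChange 𝓘(ℝ, E) (γ (t * r)) (γ (t * s)) (γ (t * r))) t
      (velocity E γ (t * r) : E)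
    refine Eq.trans ?_ h3
    exact congrArg (tangentCoordChange 𝓘(ℝ, E) (γ (t * r)) (γ (t * s)) (γ (t * r))) (hvel r hr)
  · have key : ∀ v : E, v = t • (velocity E γ (t * s) : E) →
        metricAt E (γ (t * s)) (t • t • V' : E) w + christoffel E (γ (t * s)) v v w = 0 := by
      rintro v rfl
      have h1 := metricAt_smul_left (γ (t * s)) t (t • V') w
      have h2 := metricAt_smul_left (γ (t * s)) t V' w
      have h3 := christoffel_smul_left (E := E) (γ (t * s)) t (velocity E γ (t * s))
        (t • (velocity E γ (t * s) : E)) w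
      have h4 := christoffel_smul_right (E := E) (γ (t * s)) t (velocity E γ (t * s))
        (velocity E γ (t * s)) w
      refine (congrArg₂ (· + ·) (h1.trans (congrArg (t * ·) h2))
        (h3.trans (congrArg (t * ·) h4))).trans ?_
      rw [← mul_add, ← mul_add]
      exact (congrArg (fun r : ℝ => t * (t * r)) (hVw w)).trans (by simp)
    exact key _ (hvel s hs)

omit [IsContMDiffRiemannianBundle 𝓘(ℝ, E) ∞ E (fun x : M => TangentSpace 𝓘(ℝ, E) x)] in
-- Being parallel makes the velocity continuous at each time in a chart that moves with the curve.
-- Continuity of the lift to the tangent bundle transfers this to one fixed chart. The length bound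
-- in `IsMinGeodesic.dist_le` requires a `C^1` curve.
theorem IsParallelAlong.contMDiffOn {γ : ℝ → M}
    (hγ : IsParallelAlong E γ (velocity E γ)) :
    ContMDiffOn 𝓘(ℝ, ℝ) 𝓘(ℝ, E) 1 γ (Icc (0 : ℝ) 1) := by
  have hcont : ContinuousOn γ (Icc 0 1) := fun s hs => (hγ s hs).1.continuousWithinAt
  have hlift : ContinuousOn (fun s => (⟨γ s, velocity E γ s⟩ : TangentBundle 𝓘(ℝ, E) M))
      (Icc 0 1) := by
    intro s hs
    obtain ⟨hd, V', hV', -⟩ := hγ s hs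
    exact (FiberBundle.continuousWithinAt_totalSpace _ _).2
      ⟨hd.continuousWithinAt, hV'.continuousWithinAt⟩
  intro t ht
  have hmem : γ ⁻¹' (extChartAt 𝓘(ℝ, E) (γ t)).source ∈ 𝓝[Icc (0 : ℝ) 1] t :=
    (hcont t ht).preimage_mem_nhdsWithin (extChartAt_source_mem_nhds (I := 𝓘(ℝ, E)) (γ t))
  refine contMDiffWithinAt_iff_target.2 ⟨hcont t ht, ContDiffWithinAt.contMDiffWithinAt ?_⟩
  let W : ℝ → E := fun s => tangentCoordChange 𝓘(ℝ, E) (γ s) (γ t) (γ s) (velocity E γ s)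
  have hW : ContinuousOn W (Icc 0 1 ∩ γ ⁻¹' (extChartAt 𝓘(ℝ, E) (γ t)).source) := by
    have h1 := (trivializationAt E (TangentSpace 𝓘(ℝ, E)) (γ t)).continuousOn
    have h2 := h1.comp (hlift.mono inter_subset_left) (fun s hs => by
      rw [Trivialization.mem_source]
      simpa [extChartAt_source] using mem_preimage.1 hs.2)
    rw [extChartAt_source]
    exact continuous_snd.comp_continuousOn h2
  refine (contDiffWithinAt_succ_iff_hasFDerivWithinAt' (n := 0) (by simp)).2
    ⟨Icc 0 1 ∩ γ ⁻¹' (extChartAt 𝓘(ℝ, E) (γ t)).source, ?_, ?_, by simp,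
      fun s => ContinuousLinearMap.toSpanSingleton ℝ (W s), fun s hs => ?_, ?_⟩
  · rw [insert_eq_of_mem ht]
    exact inter_mem self_mem_nhdsWithin hmem
  · exact inter_subset_left.trans (subset_insert _ _)
  · exact (hasDerivWithinAt_extChartAt_comp (γ t) (hγ s hs.1).1 hs.2).hasFDerivWithinAt
  · rw [contDiffWithinAt_zero ht]
    exact ⟨_, hmem, (ContinuousLinearMap.toSpanSingletonCLE (𝕜 := ℝ)
      (E := E)).continuous.comp_continuousOn hW⟩

theorem IsMinGeodesic.norm_velocity [FiniteDimensional ℝ E] {γ : ℝ → M} {x y : M}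
    (h : IsMinGeodesic E γ x y) {t : ℝ} (ht : t ∈ Icc (0 : ℝ) 1) :
    ‖velocity E γ t‖ = dist x y := by
  have h1 := h.parallel.metricAt_eq h.parallel ht
  rw [metricAt_self, metricAt_self] at h1
  rw [← h.speed]
  exact (sq_eq_sq₀ (norm_nonneg _) (norm_nonneg _)).1 h1

/-- The speed is constant, so the right side is the length of the arc, which dominates the
Riemannian distance. -/
theorem IsMinGeodesic.dist_le [FiniteDimensional ℝ E] [IsRiemannianManifold 𝓘(ℝ, E) M]
    {γ : ℝ → M} {x y : M} (h : IsMinGeodesic E γ x y) {a b : ℝ} (ha : 0 ≤ a) (hab : a ≤ b)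
    (hb : b ≤ 1) : dist (γ a) (γ b) ≤ (b - a) * dist x y := by
  have h1 := Manifold.riemannianEDist_le_pathELength
    (h.parallel.contMDiffOn.mono (Icc_subset_Icc ha hb)) rfl rfl hab
  rw [← IsRiemannianManifold.out (I := 𝓘(ℝ, E)) (γ a) (γ b),
    Manifold.pathELength_eq_lintegral_mfderiv_Ioo] at h1
  have h2 : ∫⁻ t in Ioo a b, ‖mfderiv 𝓘(ℝ, ℝ) 𝓘(ℝ, E) γ t 1‖ₑ =
      ∫⁻ _ in Ioo a b, ENNReal.ofReal (dist x y) := by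
    refine setLIntegral_congr_fun measurableSet_Ioo fun t ht => ?_
    have ht' : t ∈ Ioo (0 : ℝ) 1 := ⟨ha.trans_lt ht.1, ht.2.trans_le hb⟩
    have h3 := h.norm_velocity (Ioo_subset_Icc_self ht')
    rw [velocity, mfderivWithin_of_mem_nhds (Icc_mem_nhds ht'.1 ht'.2)] at h3
    rw [← h3]
    exact (ofReal_norm (E := TangentSpace 𝓘(ℝ, E) (γ t)) _).symm
  rw [h2, setLIntegral_const, Real.volume_Ioo, ← ENNReal.ofReal_mul dist_nonneg, edist_dist,
    ENNReal.ofReal_le_ofReal_iff (mul_nonneg dist_nonneg (sub_nonneg.2 hab))] at h1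
  rwa [mul_comm]

theorem IsMinGeodesic.dist_left [FiniteDimensional ℝ E] [IsRiemannianManifold 𝓘(ℝ, E) M]
    {γ : ℝ → M} {x y : M} (h : IsMinGeodesic E γ x y) {t : ℝ} (ht : t ∈ Icc (0 : ℝ) 1) :
    dist x (γ t) = t * dist x y := by
  have h1 := h.dist_le le_rfl ht.1 ht.2
  have h2 := h.dist_le ht.1 ht.2 le_rfl
  rw [h.source] at h1
  rw [h.target] at h2
  -- The upper bounds for the two arcs add up to `dist x y`, so the triangle inequality makes both
  -- sharp.
  linarith [dist_triangle x (γ t) y]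

/-- Initial segments of minimizing geodesics are minimizing geodesics. -/
theorem IsMinGeodesic.comp_mul [FiniteDimensional ℝ E] [IsRiemannianManifold 𝓘(ℝ, E) M]
    {γ : ℝ → M} {x y : M} (h : IsMinGeodesic E γ x y) {t : ℝ} (ht : t ∈ Icc (0 : ℝ) 1) :
    IsMinGeodesic E (fun s => γ (t * s)) x (γ t) where
  source := by simpa using h.source
  target := by simp
  parallel := h.parallel.velocity_comp_mul ht
  speed := by
    have h0 : (0 : ℝ) ∈ Icc (0 : ℝ) 1 := left_mem_Icc.2 zero_le_one
    have h1 := (SVRRFW.velocity_comp_mul ht h0 (h.parallel (t * 0) (by simp [h0])).1).2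
    have h2 : ‖(velocity E (fun s => γ (t * s)) 0)‖ ^ 2 = (t * dist x y) ^ 2 := by
      rw [← metricAt_self, mul_pow, ← h.norm_velocity (t := t * 0) (by simp [h0]), ← metricAt_self]
      have h3 : ∀ v : E, v = t • (velocity E γ (t * 0) : E) →
          metricAt E (γ (t * 0)) v v = t ^ 2 * metricAt E (γ (t * 0)) (velocity E γ (t * 0))
            (velocity E γ (t * 0)) := by
        rintro v rfl
        have h4 := metricAt_smul_left (E := E) (γ (t * 0)) t (velocity E γ (t * 0) : E)
          (t • (velocity E γ (t * 0) : E))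
        have h5 := metricAt_smul_right (E := E) (γ (t * 0)) t (velocity E γ (t * 0) : E)
          (velocity E γ (t * 0) : E)
        exact (h4.trans (congrArg (t * ·) h5)).trans (by ring)
      exact h3 _ h1
    rw [h.dist_left ht]
    exact (sq_eq_sq₀ (norm_nonneg _) (mul_nonneg ht.1 dist_nonneg)).1 h2

end Geometry

/-! ### Smoothness along geodesics and the Frank–Wolfe step. -/

section Geometry

open Filter Topology

variable {E : Type*} [NormedAddCommGroup E] [NormedSpace ℝ E]
  {M : Type*} [MetricSpace M] [ChartedSpace E M]
  [RiemannianBundle (fun x : M => TangentSpace 𝓘(ℝ, E) x)]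

section Gradient

variable [FiniteDimensional ℝ E]

theorem inner_rgrad (f : M → ℝ) (x : M) (v : TangentSpace 𝓘(ℝ, E) x) :
    inner ℝ (rgrad E f x) v = (mfderiv 𝓘(ℝ, E) 𝓘(ℝ, ℝ) f x v : ℝ) := by
  have := completeSpace_tangentSpace E x
  exact InnerProductSpace.toDual_symm_apply

theorem mdifferentiableAt_objective {m : ℕ} {φ : Fin m → M → ℝ} {x : M}
    (h : ∀ i, MDifferentiableAt 𝓘(ℝ, E) 𝓘(ℝ, ℝ) (φ i) x) :
    MDifferentiableAt 𝓘(ℝ, E) 𝓘(ℝ, ℝ) (objective φ) x ∧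
      rgrad E (objective φ) x = (1 / (m : ℝ)) • ∑ i, rgrad E (φ i) x := by
  have h1 : HasMFDerivAt 𝓘(ℝ, E) 𝓘(ℝ, ℝ) (∑ i, φ i) x
      (∑ i, (mfderiv 𝓘(ℝ, E) 𝓘(ℝ, ℝ) (φ i) x : TangentSpace 𝓘(ℝ, E) x →L[ℝ] ℝ)) :=
    HasMFDerivAt.sum fun i _ => (h i).hasMFDerivAt
  have h2 := h1.const_smul (1 / (m : ℝ))
  have h3 : objective φ = (1 / (m : ℝ)) • ∑ i, φ i := by
    funext y
    simp [objective]
  rw [h3]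
  refine ⟨h2.mdifferentiableAt, ?_⟩
  refine ext_inner_right ℝ fun v => ?_
  rw [inner_rgrad, h2.mfderiv, real_inner_smul_left, sum_inner]
  simp only [inner_rgrad]
  have h4 : (∑ i, (show E →L[ℝ] ℝ from mfderiv 𝓘(ℝ, E) 𝓘(ℝ, ℝ) (φ i) x)) v =
      ∑ i, (show E →L[ℝ] ℝ from mfderiv 𝓘(ℝ, E) 𝓘(ℝ, ℝ) (φ i) x) v := sum_apply _ _ _
  exact congrArg (fun r : ℝ => (1 / (m : ℝ)) * r) h4

end Gradient

variable [IsManifold 𝓘(ℝ, E) ∞ M] {X : Set M}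

theorem GeodesicallyConvex.isMinGeodesic (hX : GeodesicallyConvex E X) {x y : M} (hx : x ∈ X)
    (hy : y ∈ X) : IsMinGeodesic E (geodesicMap E x y) x y := by
  have h : ∃ γ : ℝ → M, IsMinGeodesic E γ x y := (hX x hx y hy).imp fun _ h => h.1
  rw [geodesicMap, dif_pos h]
  exact h.choose_spec

theorem GeodesicallyConvex.eqOn (hX : GeodesicallyConvex E X) {x y : M} (hx : x ∈ X)
    (hy : y ∈ X) {γ : ℝ → M} (hγ : IsMinGeodesic E γ x y) :
    EqOn (geodesicMap E x y) γ (Icc (0 : ℝ) 1) := by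
  obtain ⟨γ₀, -, -, h⟩ := hX x hx y hy
  exact (h _ (hX.isMinGeodesic hx hy)).trans (h _ hγ).symm

theorem GeodesicallyConvex.mem (hX : GeodesicallyConvex E X) {x y : M} (hx : x ∈ X)
    (hy : y ∈ X) {t : ℝ} (ht : t ∈ Icc (0 : ℝ) 1) : geodesicMap E x y t ∈ X := by
  obtain ⟨γ₀, h0, hm, -⟩ := hX x hx y hy
  rw [hX.eqOn hx hy h0 ht]
  exact hm t ht

theorem GeodesicallyConvex.norm_expInv (hX : GeodesicallyConvex E X) {x y : M} (hx : x ∈ X)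
    (hy : y ∈ X) : ‖expInv E x y‖ = dist x y := by
  have h := hX.isMinGeodesic hx hy
  have h1 : metricAt E x (expInv E x y) (expInv E x y) = dist x y ^ 2 := by
    rw [← h.speed, ← metricAt_self]
    exact metricAt_congr (E := E) h.source.symm _ _
  rw [metricAt_self] at h1
  exact (sq_eq_sq₀ (norm_nonneg _) dist_nonneg).1 h1

variable [FiniteDimensional ℝ E]

theorem LSmoothOn.objective {m : ℕ} (hm : 0 < m) {φ : Fin m → M → ℝ} {L : ℝ}
    (hφ : ∀ i, LSmoothOn E X L (φ i)) : LSmoothOn E X L (objective φ) := by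
  have hd : ∀ x ∈ X, _ := fun x hx => mdifferentiableAt_objective fun i => (hφ i).1 x hx
  refine ⟨fun x hx => (hd x hx).1, fun x hx y hy => ?_⟩
  have hm' : (0 : ℝ) < m := Nat.cast_pos.2 hm
  rw [(hd x hx).2, (hd y hy).2, map_smul, map_sum, ← smul_sub, ← Finset.sum_sub_distrib,
    norm_smul, Real.norm_of_nonneg (by positivity)]
  refine (mul_le_mul_of_nonneg_left ((norm_sum_le _ _).trans
    (Finset.sum_le_sum fun i _ => (hφ i).2 x hx y hy)) (by positivity)).trans (le_of_eq ?_)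
  simp only [Finset.sum_const, Finset.card_univ, Fintype.card_fin, nsmul_eq_mul]
  field_simp

theorem LSmoothOn.hasDerivWithinAt {f : M → ℝ} {L : ℝ} (hf : LSmoothOn E X L f)
    (hX : GeodesicallyConvex E X) {x y : M} (hx : x ∈ X)
    (hy : y ∈ X) {t : ℝ} (ht : t ∈ Icc (0 : ℝ) 1) :
    HasDerivWithinAt (fun s => f (geodesicMap E x y s))
      (inner ℝ (rgrad E f (geodesicMap E x y t)) (velocity E (geodesicMap E x y) t))
      (Icc (0 : ℝ) 1) t := by
  have h1 := (hf.1 _ (hX.mem hx hy ht)).hasMFDerivAt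
  have h2 := ((hX.isMinGeodesic hx hy).parallel t ht).1.hasMFDerivWithinAt
  have h3 := h1.comp_hasMFDerivWithinAt t h2
  have h4 : HasFDerivWithinAt (fun s => f (geodesicMap E x y s))
      ((show E →L[ℝ] ℝ from mfderiv 𝓘(ℝ, E) 𝓘(ℝ, ℝ) f (geodesicMap E x y t)).comp
        (show ℝ →L[ℝ] E from
          mfderivWithin 𝓘(ℝ, ℝ) 𝓘(ℝ, E) (geodesicMap E x y) (Icc (0 : ℝ) 1) t))
      (Icc (0 : ℝ) 1) t := hasMFDerivWithinAt_iff_hasFDerivWithinAt.mp h3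
  rw [inner_rgrad]
  exact h4.hasDerivWithinAt

variable [IsContMDiffRiemannianBundle 𝓘(ℝ, E) ∞ E (fun x : M => TangentSpace 𝓘(ℝ, E) x)]

variable [IsRiemannianManifold 𝓘(ℝ, E) M]

/-- By uniqueness, the geodesic to an intermediate point is the rescaled initial segment. Its
velocity is parallel and equals `t` times the original one; dividing by `t` requires `t ≠ 0`. -/
theorem GeodesicallyConvex.transport_expInv (hX : GeodesicallyConvex E X) {x y : M} (hx : x ∈ X)
    (hy : y ∈ X) {t : ℝ} (ht : t ∈ Ioc (0 : ℝ) 1) :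
    transport E x (geodesicMap E x y t) (expInv E x y) =
      (velocity E (geodesicMap E x y) t : E) := by
  have ht' := Ioc_subset_Icc_self ht
  have h := hX.isMinGeodesic hx hy
  have hz := hX.mem hx hy ht'
  have h0 : (0 : ℝ) ∈ Icc (0 : ℝ) 1 := left_mem_Icc.2 zero_le_one
  have h1 : (1 : ℝ) ∈ Icc (0 : ℝ) 1 := right_mem_Icc.2 zero_le_one
  have hE := hX.eqOn hx hz (h.comp_mul ht')
  have hg := hX.isMinGeodesic hx hz
  have key := (transport_spec hg).2 _ hg.parallel
  have e0 : (velocity E (geodesicMap E x (geodesicMap E x y t)) 0 : E) =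
      t • (velocity E (geodesicMap E x y) (t * 0) : E) :=
    (velocity_congr hE h0).trans
      (velocity_comp_mul ht' h0 (h.parallel (t * 0) (by simp [h0])).1).2
  have e1 : (velocity E (geodesicMap E x (geodesicMap E x y t)) 1 : E) =
      t • (velocity E (geodesicMap E x y) (t * 1) : E) :=
    (velocity_congr hE h1).trans
      (velocity_comp_mul ht' h1 (h.parallel (t * 1) (by simp [ht'.1, ht'.2])).1).2
  have e2 : (velocity E (geodesicMap E x y) (t * 0) : E) = expInv E x y := by rw [mul_zero]; rfl
  have e3 : (velocity E (geodesicMap E x y) (t * 1) : E) =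
      (velocity E (geodesicMap E x y) t : E) := by rw [mul_one]
  rw [e2] at e0
  rw [e3] at e1
  have k1 : transport E x (geodesicMap E x y t) (t • expInv E x y) =
      (t • (velocity E (geodesicMap E x y) t : E) : E) :=
    (congrArg (transport E x (geodesicMap E x y t)) e0.symm).trans (key.trans e1)
  rw [map_smul] at k1
  exact smul_right_injective E ht.1.ne' k1

/-- Transporting both vectors to `γ t` preserves the inner product at `x`. Cauchy–Schwarz then
bounds the difference by `L * (t * d)` times the speed `d`. -/
theorem LSmoothOn.inner_velocity_le {f : M → ℝ} {L : ℝ} (hf : LSmoothOn E X L f)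
    (hX : GeodesicallyConvex E X) {x y : M} (hx : x ∈ X)
    (hy : y ∈ X) {t : ℝ} (ht : t ∈ Ioc (0 : ℝ) 1) :
    inner ℝ (rgrad E f (geodesicMap E x y t)) (velocity E (geodesicMap E x y) t) ≤
      inner ℝ (rgrad E f x) (expInv E x y) + L * dist x y ^ 2 * t := by
  have ht' := Ioc_subset_Icc_self ht
  have h := hX.isMinGeodesic hx hy
  have hz := hX.mem hx hy ht'
  have hP := (transport_spec (hX.isMinGeodesic hx hz)).1 (rgrad E f x) (expInv E x y)
  rw [← hP, hX.transport_expInv hx hy ht, ← sub_le_iff_le_add', ← inner_sub_left]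
  refine (real_inner_le_norm _ _).trans ?_
  have h1 := hf.2 x hx _ hz
  rw [h.dist_left ht'] at h1
  rw [h.norm_velocity ht']
  refine (mul_le_mul_of_nonneg_right h1 dist_nonneg).trans (le_of_eq ?_)
  ring

/-- The descent lemma. -/
theorem LSmoothOn.le_of_geodesicMap {f : M → ℝ} {L : ℝ} (hf : LSmoothOn E X L f)
    (hX : GeodesicallyConvex E X) {x y : M} (hx : x ∈ X)
    (hy : y ∈ X) {t : ℝ} (ht : t ∈ Icc (0 : ℝ) 1) :
    f (geodesicMap E x y t) ≤
      f x + t * inner ℝ (rgrad E f x) (expInv E x y) + L * dist x y ^ 2 / 2 * t ^ 2 := by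
  set c := inner ℝ (rgrad E f x) (expInv E x y)
  have hd : ∀ s ∈ Icc (0 : ℝ) 1, HasDerivWithinAt
      (fun s => f (geodesicMap E x y s) - (s * c + L * dist x y ^ 2 / 2 * s ^ 2))
      (inner ℝ (rgrad E f (geodesicMap E x y s)) (velocity E (geodesicMap E x y) s) -
        (c + L * dist x y ^ 2 * s)) (Icc (0 : ℝ) 1) s := by
    intro s hs
    have h1 : HasDerivAt (fun s : ℝ => s * c + L * dist x y ^ 2 / 2 * s ^ 2)
        (c + L * dist x y ^ 2 * s) s := by
      refine (((hasDerivAt_id s).mul_const c).fun_add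
        ((hasDerivAt_pow 2 s).const_mul (L * dist x y ^ 2 / 2))).congr_deriv ?_
      simp
      ring
    exact (hf.hasDerivWithinAt hX hx hy hs).fun_sub h1.hasDerivWithinAt
  have hanti : AntitoneOn
      (fun s => f (geodesicMap E x y s) - (s * c + L * dist x y ^ 2 / 2 * s ^ 2))
      (Icc (0 : ℝ) 1) := by
    refine antitoneOn_of_hasDerivWithinAt_nonpos (convex_Icc 0 1)
      (fun s hs => (hd s hs).continuousWithinAt)
      (fun s hs => (hd s (interior_subset hs)).mono interior_subset) (fun s hs => ?_)
    rw [interior_Icc] at hs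
    exact sub_nonpos.2 (hf.inner_velocity_le hX hx hy (Ioo_subset_Ioc_self hs))
  have h := hanti (left_mem_Icc.2 zero_le_one) ht ht.1
  simp only [(hX.isMinGeodesic hx hy).source] at h
  linarith

/-- One Frank–Wolfe step with the inexact gradient `g` contracts the optimality gap. -/
theorem IsLinearOracle.step_le {f : M → ℝ} {L D η : ℝ} (hL : 0 ≤ L) (hf : LSmoothOn E X L f)
    (hX : GeodesicallyConvex E X) (hD : ∀ x ∈ X, ∀ y ∈ X, dist x y ≤ D) (hconv : GConvexOn E X f)
    {rlo : (x : M) → TangentSpace 𝓘(ℝ, E) x → M} (hrlo : IsLinearOracle E X rlo) {x xs : M}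
    (hx : x ∈ X) (hxs : xs ∈ X) (g : TangentSpace 𝓘(ℝ, E) x) (hη : η ∈ Icc (0 : ℝ) 1) :
    f (geodesicMap E x (rlo x g) η) - f xs ≤
      (1 - η) * (f x - f xs) + 2 * D * η * ‖g - rgrad E f x‖ + L * D ^ 2 / 2 * η ^ 2 := by
  obtain ⟨hz, hmin⟩ := hrlo x hx g
  have h1 := hf.le_of_geodesicMap hX hx hz hη
  have h2 := hmin xs hxs
  have h3 := hconv x hx xs hxs
  have h4 : L * dist x (rlo x g) ^ 2 / 2 * η ^ 2 ≤ L * D ^ 2 / 2 * η ^ 2 := by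
    have := hD x hx _ hz
    have h0 : (0 : ℝ) ≤ dist x (rlo x g) := dist_nonneg
    gcongr
  -- The cost of optimizing with `g` instead of the gradient: two tangent vectors, each of norm at
  -- most `D`, account for the factor `2 * D`.
  have h5 : inner ℝ (rgrad E f x - g) (expInv E x (rlo x g) - expInv E x xs) ≤
      ‖g - rgrad E f x‖ * (D + D) := by
    refine (real_inner_le_norm _ _).trans ?_
    rw [norm_sub_rev]
    refine mul_le_mul_of_nonneg_left ((norm_sub_le _ _).trans ?_) (norm_nonneg _)
    rw [hX.norm_expInv hx hz, hX.norm_expInv hx hxs]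
    exact add_le_add (hD x hx _ hz) (hD x hx _ hxs)
  rw [inner_sub_left, inner_sub_right, inner_sub_right] at h5
  have h6 : inner ℝ (rgrad E f x) (expInv E x (rlo x g)) ≤
      ‖g - rgrad E f x‖ * (D + D) - (f x - f xs) := by linarith
  have h7 := mul_le_mul_of_nonneg_left h6 hη.1
  nlinarith

end Geometry

/-! ### Finitely valued random variables and minibatch means. -/

section Probability

variable {Ω : Type*} [MeasurableSpace Ω] {μ : Measure Ω}

section Finite

variable {α β : Type*} [Finite α] [MeasurableSpace α] [MeasurableSingletonClass α]
  [Finite β] [MeasurableSpace β] [MeasurableSingletonClass β]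

/-- On a finite space with measurable points every function is measurable, so `F` may involve an
arbitrary oracle. -/
theorem integrable_comp_of_finite [IsFiniteMeasure μ] {A : Ω → α} (hA : Measurable A)
    (F : α → ℝ) : Integrable (fun o => F (A o)) μ :=
  (Integrable.of_finite (f := F) (μ := μ.map A)).comp_measurable hA

theorem integral_comp_uniform {m : ℕ} [IsFiniteMeasure μ] {A : Ω → Fin m} (hA : Measurable A)
    (hu : ∀ j, μ (A ⁻¹' {j}) = ((m : ENNReal))⁻¹) (F : Fin m → ℝ) :
    ∫ o, F (A o) ∂μ = (1 / (m : ℝ)) * ∑ j, F j := by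
  rw [← integral_map hA.aemeasurable (Integrable.of_finite (f := F)).aestronglyMeasurable,
    integral_fintype Integrable.of_finite, Finset.mul_sum]
  refine Finset.sum_congr rfl fun j _ => ?_
  rw [measureReal_def, Measure.map_apply hA (measurableSet_singleton j), hu]
  simp

theorem integral_comp_indepFun [IsProbabilityMeasure μ] {A : Ω → α} {B : Ω → β}
    (hA : Measurable A) (hB : Measurable B) (h : IndepFun A B μ) (F : α → β → ℝ) :
    ∫ o, F (A o) (B o) ∂μ = ∫ o, ∫ o', F (A o) (B o') ∂μ ∂μ := by
  have : IsProbabilityMeasure (μ.map A) := Measure.isProbabilityMeasure_map hA.aemeasurable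
  have : IsProbabilityMeasure (μ.map B) := Measure.isProbabilityMeasure_map hB.aemeasurable
  have h1 := integral_map (μ := μ) (hA.prodMk hB).aemeasurable
    (f := fun p : α × β => F p.1 p.2) Integrable.of_finite.aestronglyMeasurable
  rw [(indepFun_iff_map_prod_eq_prod_map_map hA.aemeasurable hB.aemeasurable).1 h,
    integral_prod _ Integrable.of_finite] at h1
  rw [← h1, integral_map hA.aemeasurable Integrable.of_finite.aestronglyMeasurable]
  congr 1
  funext o
  exact integral_map hB.aemeasurable (f := fun b => F (A o) b)
    Integrable.of_finite.aestronglyMeasurable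

end Finite

theorem sq_integral_le_integral_sq [IsProbabilityMeasure μ] {f : Ω → ℝ} (hf : Integrable f μ)
    (hf2 : Integrable (fun o => f o ^ 2) μ) : (∫ o, f o ∂μ) ^ 2 ≤ ∫ o, f o ^ 2 ∂μ := by
  have h0 : 0 ≤ ∫ o, (f o - ∫ o, f o ∂μ) ^ 2 ∂μ := integral_nonneg fun o => sq_nonneg _
  have h1 : ∫ o, (f o - ∫ o, f o ∂μ) ^ 2 ∂μ =
      ∫ o, (f o ^ 2 - 2 * (∫ o, f o ∂μ) * f o + (∫ o, f o ∂μ) ^ 2) ∂μ :=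
    integral_congr_ae (Filter.Eventually.of_forall fun o => by ring)
  have h2 : Integrable (fun o => f o ^ 2 - 2 * (∫ o, f o ∂μ) * f o) μ :=
    hf2.sub (hf.const_mul _)
  rw [h1, integral_add h2 (integrable_const _), integral_sub hf2 (hf.const_mul _), integral_const_mul, integral_const, probReal_univ,
    one_smul] at h0
  linarith

/-- A minibatch mean of a centered family has variance at most that of the family divided by the
size of the batch. -/
theorem integral_norm_sq_batch_mean {H : Type*} [NormedAddCommGroup H] [InnerProductSpace ℝ H]
    {m b : ℕ} [IsProbabilityMeasure μ] {i : Fin b → Ω → Fin m} (hi : ∀ l, Measurable (i l))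
    (hu : ∀ l j, μ (i l ⁻¹' {j}) = ((m : ENNReal))⁻¹)
    (hind : ∀ l l', l ≠ l' → IndepFun (i l) (i l') μ) {Y : Fin m → H} (hY : ∑ j, Y j = 0) :
    ∫ o, ‖(1 / (b : ℝ)) • ∑ l, Y (i l o)‖ ^ 2 ∂μ =
      1 / (b : ℝ) * ((1 / (m : ℝ)) * ∑ j, ‖Y j‖ ^ 2) := by
  have hint : ∀ l l', Integrable (fun o => inner ℝ (Y (i l o)) (Y (i l' o))) μ := fun l l' =>
    integrable_comp_of_finite ((hi l).prodMk (hi l')) (fun p => inner ℝ (Y p.1) (Y p.2))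
  have hcross : ∀ l l', ∫ o, inner ℝ (Y (i l o)) (Y (i l' o)) ∂μ =
      if l = l' then (1 / (m : ℝ)) * ∑ j, ‖Y j‖ ^ 2 else 0 := by
    intro l l'
    split_ifs with h
    · subst h
      simp only [real_inner_self_eq_norm_sq]
      exact integral_comp_uniform (hi l) (hu l) fun j => ‖Y j‖ ^ 2
    -- Cross terms vanish: with the first sample fixed, averaging over the second gives a multiple
    -- of `∑ j, Y j = 0`.
    · rw [integral_comp_indepFun (hi l) (hi l') (hind l l' h) fun a c => inner ℝ (Y a) (Y c)]
      refine integral_eq_zero_of_ae (Filter.Eventually.of_forall fun o => ?_)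
      beta_reduce
      rw [integral_comp_uniform (hi l') (hu l') fun c => inner ℝ (Y (i l o)) (Y c),
        ← inner_sum, hY, inner_zero_right, mul_zero]
      rfl
  have hexp : ∀ o, ‖(1 / (b : ℝ)) • ∑ l, Y (i l o)‖ ^ 2 =
      (1 / (b : ℝ)) ^ 2 * ∑ l, ∑ l', inner ℝ (Y (i l o)) (Y (i l' o)) := by
    intro o
    rw [norm_smul, mul_pow, ← real_inner_self_eq_norm_sq (∑ l, Y (i l o)), sum_inner,
      Real.norm_eq_abs, sq_abs]
    simp only [inner_sum]
  simp only [hexp]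
  rw [integral_const_mul, integral_finsetSum _ fun l _ => integrable_finsetSum _ fun l' _ =>
    hint l l']
  simp only [integral_finsetSum _ fun l' _ => hint _ l', hcross, Finset.sum_ite_eq,
    Finset.mem_univ, if_true, Finset.sum_const, Finset.card_univ, Fintype.card_fin, nsmul_eq_mul]
  rcases Nat.eq_zero_or_pos b with rfl | hb
  · simp
  · have : (b : ℝ) ≠ 0 := by positivity
    field_simp

/-- The expected error of a minibatch mean of vectors of norm at most `c`. -/
theorem integral_norm_batch_error_le {H : Type*} [NormedAddCommGroup H] [InnerProductSpace ℝ H]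
    {m b : ℕ} (hm : 0 < m) [IsProbabilityMeasure μ] {i : Fin b → Ω → Fin m}
    (hi : ∀ l, Measurable (i l))
    (hu : ∀ l j, μ (i l ⁻¹' {j}) = ((m : ENNReal))⁻¹)
    (hind : ∀ l l', l ≠ l' → IndepFun (i l) (i l') μ) {A : Fin m → H} {c : ℝ}
    (hA : ∀ j, ‖A j‖ ≤ c) :
    ∫ o, ‖(1 / (b : ℝ)) • ∑ l, (A (i l o) - (1 / (m : ℝ)) • ∑ j, A j)‖ ∂μ ≤ c / √b := by
  have hm' : (0 : ℝ) < m := Nat.cast_pos.2 hm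
  have hc : 0 ≤ c := (norm_nonneg _).trans (hA ⟨0, hm⟩)
  set a := (1 / (m : ℝ)) • ∑ j, A j with ha
  have hsum : ∑ j, A j = (m : ℝ) • a := by
    rw [ha, smul_smul, mul_one_div_cancel hm'.ne', one_smul]
  have hY : ∑ j, (A j - a) = 0 := by
    rw [Finset.sum_sub_distrib, hsum, Finset.sum_const, Finset.card_univ, Fintype.card_fin,
      Nat.cast_smul_eq_nsmul, sub_self]
  -- Centring at the mean only decreases the second moment.
  have hvar : (1 / (m : ℝ)) * ∑ j, ‖A j - a‖ ^ 2 ≤ c ^ 2 := by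
    have h1 : ∑ j, ‖A j - a‖ ^ 2 = ∑ j, ‖A j‖ ^ 2 - m * ‖a‖ ^ 2 := by
      simp only [norm_sub_sq_real, Finset.sum_add_distrib, Finset.sum_sub_distrib,
        ← Finset.mul_sum, ← sum_inner, hsum, real_inner_smul_left, real_inner_self_eq_norm_sq,
        Finset.sum_const, Finset.card_univ, Fintype.card_fin, nsmul_eq_mul]
      ring
    have h2 : ∑ j, ‖A j‖ ^ 2 ≤ m * c ^ 2 := by
      refine (Finset.sum_le_sum fun j _ => pow_le_pow_left₀ (norm_nonneg _) (hA j) 2).trans ?_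
      simp
    rw [h1, one_div, inv_mul_le_iff₀ hm']
    have : 0 ≤ m * ‖a‖ ^ 2 := by positivity
    linarith
  have hmeas : Measurable fun o l => i l o := measurable_pi_lambda _ hi
  have h3 := sq_integral_le_integral_sq
    (integrable_comp_of_finite (μ := μ) hmeas fun I => ‖(1 / (b : ℝ)) • ∑ l, (A (I l) - a)‖)
    (integrable_comp_of_finite (μ := μ) hmeas fun I => ‖(1 / (b : ℝ)) • ∑ l, (A (I l) - a)‖ ^ 2)
  rw [integral_norm_sq_batch_mean hi hu hind hY] at h3
  refine abs_le_of_sq_le_sq' (h3.trans ?_) (by positivity) |>.2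
  rw [div_pow, Real.sq_sqrt (Nat.cast_nonneg b), div_eq_mul_one_div (c ^ 2), mul_comm (c ^ 2)]
  exact mul_le_mul_of_nonneg_left hvar (by positivity)

theorem IsUniformSampling.measurable_sample {m b K S : ℕ} {i : ℕ → ℕ → Fin b → Ω → Fin m}
    (hi : IsUniformSampling μ m b K S i) :
    Measurable fun o (p : Fin S × Fin K × Fin b) => i p.1 p.2.1 p.2.2 o :=
  measurable_pi_lambda _ fun p => hi.measurable p.1 p.2.1 p.2.2

/-- A minibatch is independent of the earlier ones. -/
theorem IsUniformSampling.integral_eq {m b K S : ℕ} [IsProbabilityMeasure μ] (hm : 0 < m)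
    {i : ℕ → ℕ → Fin b → Ω → Fin m} (hi : IsUniformSampling μ m b K S i) {s k : ℕ}
    (hs : s < S) (hk : k < K) (G : (ℕ → ℕ → Fin b → Fin m) → (Fin b → Fin m) → ℝ)
    (hG : ∀ I J c, (∀ s' < s, ∀ k' < K, I s' k' = J s' k') → (∀ k' < k, I s k' = J s k') →
      G I c = G J c) :
    ∫ o, G (fun s k l => i s k l o) (fun l => i s k l o) ∂μ =
      ∫ o, ∫ o', G (fun s k l => i s k l o) (fun l => i s k l o') ∂μ ∂μ := by
  classical
  -- `T` collects the indices drawn before iteration `k` of epoch `s`, `T'` those of the current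
  -- minibatch.
  let T : Finset (Fin S × Fin K × Fin b) :=
    Finset.univ.filter fun p => p.1.1 < s ∨ (p.1.1 = s ∧ p.2.1.1 < k)
  let T' : Finset (Fin S × Fin K × Fin b) :=
    Finset.univ.filter fun p => p.1.1 = s ∧ p.2.1.1 = k
  have hT : Disjoint T T' := by
    rw [Finset.disjoint_filter]
    rintro p - h ⟨h1, h2⟩
    omega
  have hmeas : ∀ p : Fin S × Fin K × Fin b, Measurable (i p.1 p.2.1 p.2.2) :=
    fun p => hi.measurable _ _ _
  have hind := hi.indep.indepFun_finset T T' hT hmeas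
  -- Rebuilds an index table from past samples alone. The value `0` off `T` is harmless, since by
  -- `hG` the function `G` reads only past entries of its first argument.
  let ext : (T → Fin m) → ℕ → ℕ → Fin b → Fin m := fun a s' k' l =>
    if h : ∃ (h1 : s' < S) (h2 : k' < K), ((⟨s', h1⟩, ⟨k', h2⟩, l) : Fin S × Fin K × Fin b) ∈ T
    then a ⟨_, h.choose_spec.choose_spec⟩ else ⟨0, hm⟩
  let cur : (T' → Fin m) → Fin b → Fin m := fun c l =>
    c ⟨(⟨s, hs⟩, ⟨k, hk⟩, l), by simp [T']⟩
  have hext : ∀ o c, G (fun s k l => i s k l o) c =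
      G (ext fun p => i p.1.1 p.1.2.1 p.1.2.2 o) c := by
    intro o c
    refine hG _ _ _ (fun s' hs' k' hk' => ?_) (fun k' hk' => ?_)
    · funext l
      have h : ∃ (h1 : s' < S) (h2 : k' < K),
          ((⟨s', h1⟩, ⟨k', h2⟩, l) : Fin S × Fin K × Fin b) ∈ T :=
        ⟨hs'.trans hs, hk', by simp [T, hs']⟩
      simp only [ext, dif_pos h]
    · funext l
      have h : ∃ (h1 : s < S) (h2 : k' < K),
          ((⟨s, h1⟩, ⟨k', h2⟩, l) : Fin S × Fin K × Fin b) ∈ T :=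
        ⟨hs, hk'.trans hk, by simp [T, hk']⟩
      simp only [ext, dif_pos h]
  have := integral_comp_indepFun (measurable_pi_lambda _ fun p => hmeas p.1)
    (measurable_pi_lambda _ fun p => hmeas p.1) hind fun a c => G (ext a) (cur c)
  simp only [hext]
  exact this

end Probability

/-! ### Dependence on past samples and the form of the gradient error. -/

section Algorithm

variable {E : Type*} [NormedAddCommGroup E] [NormedSpace ℝ E] [FiniteDimensional ℝ E]
  {M : Type*} [MetricSpace M] [ChartedSpace E M] [IsManifold 𝓘(ℝ, E) ∞ M]
  [RiemannianBundle (fun x : M => TangentSpace 𝓘(ℝ, E) x)] {m b : ℕ}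
  {φ : Fin m → M → ℝ} {rlo : (x : M) → TangentSpace 𝓘(ℝ, E) x → M} {η : ℝ} {K : ℕ}

theorem epoch_congr {I J : ℕ → Fin b → Fin m} (xt : M) :
    ∀ k, (∀ j < k, I j = J j) → epoch E φ rlo η I xt k = epoch E φ rlo η J xt k
  | 0, _ => rfl
  | k + 1, h => by
    rw [epoch, epoch, epoch_congr xt k fun j hj => h j (hj.trans k.lt_succ_self),
      h k k.lt_succ_self]

theorem anchor_congr {I J : ℕ → ℕ → Fin b → Fin m} (x0 : M) :
    ∀ s, (∀ s' < s, ∀ k < K, I s' k = J s' k) →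
      anchor E φ rlo η K I x0 s = anchor E φ rlo η K J x0 s
  | 0, _ => rfl
  | s + 1, h => by
    simp only [anchor, anchor_congr x0 s fun s' hs' => h s' (hs'.trans s.lt_succ_self)]
    exact epoch_congr _ K (h s s.lt_succ_self)

/-- The transported full gradient at the anchor cancels. What remains is a minibatch mean of centred
differences, each of which `L`-smoothness bounds before centring. -/
theorem vrGrad_sub_rgrad (hb : 0 < b) {x : M} (xt : M)
    (hx : ∀ i, MDifferentiableAt 𝓘(ℝ, E) 𝓘(ℝ, ℝ) (φ i) x)
    (hxt : ∀ i, MDifferentiableAt 𝓘(ℝ, E) 𝓘(ℝ, ℝ) (φ i) xt) (I : Fin b → Fin m) :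
    vrGrad E φ I xt x - rgrad E (objective φ) x = (1 / (b : ℝ)) • ∑ l,
      ((rgrad E (φ (I l)) x - transport E xt x (rgrad E (φ (I l)) xt)) - (1 / (m : ℝ)) •
        ∑ j, (rgrad E (φ j) x - transport E xt x (rgrad E (φ j) xt))) := by
  have hb' : (b : ℝ) ≠ 0 := Nat.cast_ne_zero.2 hb.ne'
  have h1 : rgrad E (objective φ) x = (1 / (m : ℝ)) •
      ∑ j, (rgrad E (φ j) x - transport E xt x (rgrad E (φ j) xt)) +
        transport E xt x (rgrad E (objective φ) xt) := by
    rw [(mdifferentiableAt_objective hx).2, (mdifferentiableAt_objective hxt).2,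
      Finset.sum_sub_distrib, map_smul, map_sum, ← smul_add, sub_add_cancel]
  refine (congrArg (vrGrad E φ I xt x - ·) h1).trans ?_
  simp only [vrGrad, map_sub, Finset.sum_sub_distrib, smul_sub, Finset.sum_const, Finset.card_univ,
    Fintype.card_fin, ← Nat.cast_smul_eq_nsmul ℝ, smul_smul, one_div, inv_mul_cancel₀ hb',
    inv_mul_cancel_left₀ hb', one_smul]
  abel

end Algorithm

/-! ### The scalar recursion. -/

/-- Nested form of a contraction with additive error, together with its telescoped sum. -/
theorem nested_contraction_le {e : ℕ → ℕ → ℝ} {K S : ℕ} {η c Δ : ℝ} (hη : η ∈ Icc (0 : ℝ) 1)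
    (hΔ : e 0 0 ≤ Δ) (he : ∀ s k, 0 ≤ e s k)
    (hc : 0 ≤ c) (hnext : ∀ s, e (s + 1) 0 = e s K)
    (hstep : ∀ s < S, ∀ k < K, e s (k + 1) ≤ (1 - η) * e s k + c * η ^ 2) :
    e S 0 ≤ (1 - η) ^ (K * S) * Δ + c * η ∧
      η * ∑ s ∈ Finset.range S, ∑ k ∈ Finset.range K, e s k ≤ Δ + c * η ^ 2 * (K * S) := by
  have h1η : 0 ≤ 1 - η := sub_nonneg.2 hη.2
  -- `n` counts the iterations of earlier epochs. The offset `c * η` is the fixed point of `u ↦ (1 -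
  -- η) * u + c * η ^ 2`.
  have hinner : ∀ s < S, ∀ n, e s 0 ≤ (1 - η) ^ n * Δ + c * η → ∀ k ≤ K,
      e s k ≤ (1 - η) ^ (n + k) * Δ + c * η := by
    intro s hs n h0 k
    induction k with
    | zero => exact fun _ => h0
    | succ k ih =>
      intro hk
      refine (hstep s hs k hk).trans ?_
      have := mul_le_mul_of_nonneg_left (ih (Nat.le_of_succ_le hk)) h1η
      rw [← add_assoc, pow_succ (1 - η)]
      linarith
  have houter : ∀ s ≤ S, e s 0 ≤ (1 - η) ^ (K * s) * Δ + c * η := by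
    intro s
    induction s with
    | zero =>
      intro _
      have : 0 ≤ c * η := mul_nonneg hc hη.1
      simpa using hΔ.trans (le_add_of_nonneg_right this)
    | succ s ih =>
      intro hs
      rw [hnext, Nat.mul_succ]
      exact hinner s hs _ (ih (Nat.le_of_succ_le hs)) K le_rfl
  refine ⟨houter S le_rfl, ?_⟩
  have hsum : ∀ s < S, ∀ k ≤ K, η * ∑ j ∈ Finset.range k, e s j ≤
      e s 0 - e s k + c * η ^ 2 * k := by
    intro s hs k
    induction k with
    | zero => simp
    | succ k ih =>
      intro hk
      have h1 := ih (Nat.le_of_succ_le hk)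
      have h2 := hstep s hs k hk
      rw [Finset.sum_range_succ]
      push_cast
      linarith
  have hsum' : ∀ s ≤ S, η * ∑ j ∈ Finset.range s, ∑ k ∈ Finset.range K, e j k ≤
      e 0 0 - e s 0 + c * η ^ 2 * (K * s) := by
    intro s
    induction s with
    | zero => simp
    | succ s ih =>
      intro hs
      have h1 := ih (Nat.le_of_succ_le hs)
      have h2 := hsum s hs K le_rfl
      rw [Finset.sum_range_succ, hnext]
      push_cast
      linarith
  linarith [hsum' S le_rfl, he S 0]

/-- From `1 - u ≤ exp (-u)` the left side is at most `exp (-√n)`, and `exp √n ≥ √n + 1`. -/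
theorem one_sub_inv_sqrt_pow_le {n : ℕ} (hn : 0 < n) : (1 - 1 / √(n : ℝ)) ^ n ≤ 1 / √(n : ℝ) := by
  have hn' : (1 : ℝ) ≤ n := Nat.one_le_cast.2 hn
  have hs : 1 ≤ √(n : ℝ) := Real.one_le_sqrt.2 hn'
  have hs0 : 0 < √(n : ℝ) := one_pos.trans_le hs
  have h1 : 1 - 1 / √(n : ℝ) ≤ Real.exp (-(1 / √(n : ℝ))) := by
    linarith [Real.add_one_le_exp (-(1 / √(n : ℝ)))]
  have h0 : 0 ≤ 1 - 1 / √(n : ℝ) := by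
    rw [sub_nonneg, div_le_one hs0]
    exact hs
  refine (pow_le_pow_left₀ h0 h1 n).trans ?_
  rw [← Real.exp_nat_mul]
  have h2 : (n : ℝ) * -(1 / √(n : ℝ)) = -√(n : ℝ) := by
    have := Real.mul_self_sqrt (Nat.cast_nonneg (α := ℝ) n)
    field_simp
    linarith
  rw [h2, Real.exp_neg, one_div]
  exact inv_anti₀ hs0 (by linarith [Real.add_one_le_exp √(n : ℝ)])

theorem IsUniformSampling.integrable {Ω : Type*} [MeasurableSpace Ω] {μ : Measure Ω}
    [IsFiniteMeasure μ] {m b K S : ℕ} (hm : 0 < m)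
    {i : ℕ → ℕ → Fin b → Ω → Fin m} (hi : IsUniformSampling μ m b K S i)
    (G : (ℕ → ℕ → Fin b → Fin m) → ℝ)
    (hG : ∀ I J, (∀ s < S, ∀ k < K, I s k = J s k) → G I = G J) :
    Integrable (fun o => G fun s k l => i s k l o) μ := by
  let ext : (Fin S × Fin K × Fin b → Fin m) → ℕ → ℕ → Fin b → Fin m := fun a s k l =>
    if h : s < S ∧ k < K then a (⟨s, h.1⟩, ⟨k, h.2⟩, l) else ⟨0, hm⟩
  have h : ∀ o, G (fun s k l => i s k l o) = G (ext fun p => i p.1 p.2.1 p.2.2 o) := fun o =>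
    hG _ _ fun s hs k hk => by
      funext l
      simp only [ext, dif_pos (And.intro hs hk)]
  simp only [h]
  exact integrable_comp_of_finite hi.measurable_sample fun a => G (ext a)

/-! ### Feasibility of the iterates and the error of the gradient estimate. -/

section Algorithm

variable {E : Type*} [NormedAddCommGroup E] [NormedSpace ℝ E] [FiniteDimensional ℝ E]
  {M : Type*} [MetricSpace M] [ChartedSpace E M] [IsManifold 𝓘(ℝ, E) ∞ M]
  [RiemannianBundle (fun x : M => TangentSpace 𝓘(ℝ, E) x)] {m b : ℕ}
  {φ : Fin m → M → ℝ} {rlo : (x : M) → TangentSpace 𝓘(ℝ, E) x → M} {η : ℝ} {K S : ℕ} {X : Set M}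

theorem iterate_congr {I J : ℕ → ℕ → Fin b → Fin m} (x0 : M) {s k : ℕ}
    (hs : ∀ s' < s, ∀ k' < K, I s' k' = J s' k') (hk : ∀ k' < k, I s k' = J s k') :
    iterate E φ rlo η K I x0 s k = iterate E φ rlo η K J x0 s k := by
  rw [iterate, iterate, anchor_congr x0 s hs, epoch_congr _ k hk]

theorem epoch_mem (hX : GeodesicallyConvex E X) (hrlo : IsLinearOracle E X rlo)
    (hη : η ∈ Icc (0 : ℝ) 1) (I : ℕ → Fin b → Fin m) {xt : M} (hxt : xt ∈ X) :
    ∀ k, epoch E φ rlo η I xt k ∈ X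
  | 0 => hxt
  | k + 1 =>
    have h := epoch_mem hX hrlo hη I hxt k
    hX.mem h (hrlo _ h _).1 hη

theorem anchor_mem (hX : GeodesicallyConvex E X) (hrlo : IsLinearOracle E X rlo)
    (hη : η ∈ Icc (0 : ℝ) 1) (I : ℕ → ℕ → Fin b → Fin m) {x0 : M} (hx0 : x0 ∈ X) :
    ∀ s, anchor E φ rlo η K I x0 s ∈ X
  | 0 => hx0
  | s + 1 => epoch_mem hX hrlo hη (I s) (anchor_mem hX hrlo hη I hx0 s) K

theorem iterate_mem (hX : GeodesicallyConvex E X) (hrlo : IsLinearOracle E X rlo)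
    (hη : η ∈ Icc (0 : ℝ) 1) (I : ℕ → ℕ → Fin b → Fin m) {x0 : M} (hx0 : x0 ∈ X) (s k : ℕ) :
    iterate E φ rlo η K I x0 s k ∈ X :=
  epoch_mem hX hrlo hη (I s) (anchor_mem hX hrlo hη I hx0 s) k

variable [IsContMDiffRiemannianBundle 𝓘(ℝ, E) ∞ E (fun x : M => TangentSpace 𝓘(ℝ, E) x)]
  [IsRiemannianManifold 𝓘(ℝ, E) M]

/-- Each iteration travels a fraction `η` of a geodesic of length at most `D`. -/
theorem dist_epoch_le {D : ℝ} (hX : GeodesicallyConvex E X) (hD : ∀ x ∈ X, ∀ y ∈ X, dist x y ≤ D)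
    (hrlo : IsLinearOracle E X rlo) (hη : η ∈ Icc (0 : ℝ) 1) (I : ℕ → Fin b → Fin m) {xt : M}
    (hxt : xt ∈ X) (k : ℕ) : dist xt (epoch E φ rlo η I xt k) ≤ k * (η * D) := by
  induction k with
  | zero => simp [epoch]
  | succ k ih =>
    have h := epoch_mem (φ := φ) hX hrlo hη I hxt k
    have hz := (hrlo _ h (vrGrad E φ (I k) xt (epoch E φ rlo η I xt k))).1
    refine (dist_triangle _ (epoch E φ rlo η I xt k) _).trans ?_
    rw [epoch, (hX.isMinGeodesic h hz).dist_left hη]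
    have := mul_le_mul_of_nonneg_left (hD _ h _ hz) hη.1
    push_cast
    linarith

variable {Ω : Type*} [MeasurableSpace Ω] {μ : Measure Ω} [IsProbabilityMeasure μ]

/-- Within an epoch with minibatches of size `K ^ 2`, the expected error of the variance-reduced
gradient is at most `L * D * η`. -/
theorem integral_norm_vrGrad_sub_le {L D : ℝ} (hL : 0 ≤ L) (hm : 0 < m)
    (hφ : ∀ i, LSmoothOn E X L (φ i))
    (hX : GeodesicallyConvex E X) (hD : ∀ x ∈ X, ∀ y ∈ X, dist x y ≤ D)
    (hrlo : IsLinearOracle E X rlo) (hη : η ∈ Icc (0 : ℝ) 1)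
    {i : ℕ → ℕ → Fin (K ^ 2) → Ω → Fin m} (hi : IsUniformSampling μ m (K ^ 2) K S i)
    {x0 : M} (hx0 : x0 ∈ X) {s k : ℕ} (hs : s < S) (hk : k < K) :
    ∫ o, ‖vrGrad E φ (fun l => i s k l o)
        (anchor E φ rlo η K (fun s k l => i s k l o) x0 s)
        (iterate E φ rlo η K (fun s k l => i s k l o) x0 s k) -
      rgrad E (objective φ) (iterate E φ rlo η K (fun s k l => i s k l o) x0 s k)‖ ∂μ ≤
      L * D * η := by
  have hK : 0 < K := (Nat.zero_le k).trans_lt hk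
  have hK' : (0 : ℝ) < K := Nat.cast_pos.2 hK
  have hD0 : 0 ≤ D := dist_nonneg.trans (hD x0 hx0 x0 hx0)
  rw [hi.integral_eq hm hs hk
    (fun I c => ‖vrGrad E φ c (anchor E φ rlo η K I x0 s) (iterate E φ rlo η K I x0 s k) -
      rgrad E (objective φ) (iterate E φ rlo η K I x0 s k)‖)
    (fun I J c h1 h2 => by rw [iterate_congr x0 h1 h2, anchor_congr x0 s h1])]
  have hbound : ∀ I : ℕ → ℕ → Fin (K ^ 2) → Fin m,
      ∫ o, ‖vrGrad E φ (fun l => i s k l o) (anchor E φ rlo η K I x0 s)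
        (iterate E φ rlo η K I x0 s k) -
        rgrad E (objective φ) (iterate E φ rlo η K I x0 s k)‖ ∂μ ≤ L * D * η := by
    intro I
    have hxt := anchor_mem (φ := φ) (K := K) hX hrlo hη I hx0 s
    have hx := iterate_mem (φ := φ) (K := K) hX hrlo hη I hx0 s k
    have hdist : dist (anchor E φ rlo η K I x0 s) (iterate E φ rlo η K I x0 s k) ≤ K * (η * D) :=
      (dist_epoch_le hX hD hrlo hη (I s) hxt k).trans
        (mul_le_mul_of_nonneg_right (Nat.cast_le.2 hk.le) (mul_nonneg hη.1 hD0))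
    simp only [fun c => vrGrad_sub_rgrad (φ := φ) (by positivity : 0 < K ^ 2)
      (anchor E φ rlo η K I x0 s) (fun i => (hφ i).1 _ hx) (fun i => (hφ i).1 _ hxt) c]
    refine (integral_norm_batch_error_le hm (fun l => hi.measurable s k l)
      (fun l j => hi.uniform s hs k hk l j) (fun l l' hll => ?_)
      (fun j => ((hφ j).2 _ hxt _ hx).trans (mul_le_mul_of_nonneg_left hdist hL))).trans
      (le_of_eq ?_)
    · exact hi.indep.indepFun (i := (⟨s, hs⟩, ⟨k, hk⟩, l)) (j := (⟨s, hs⟩, ⟨k, hk⟩, l'))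
        (by simpa using hll)
    -- The batch size `K ^ 2` contributes `√(K ^ 2) = K`, which cancels the drift factor `K`.
    · rw [Nat.cast_pow, Real.sqrt_sq hK'.le]
      field_simp
  refine (integral_mono_of_nonneg (Filter.Eventually.of_forall fun o =>
    integral_nonneg fun o' => norm_nonneg _) (integrable_const (L * D * η))
    (Filter.Eventually.of_forall fun o => hbound fun s k l => i s k l o)).trans ?_
  simp

end Algorithm

end SVRRFW

/-! ### Assembly of the two rates. -/

theorem mainTheorem6
    {E : Type*} [NormedAddCommGroup E] [NormedSpace ℝ E] [FiniteDimensional ℝ E]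
    {M : Type*} [MetricSpace M] [ChartedSpace E M] [IsManifold 𝓘(ℝ, E) ∞ M]
    [RiemannianBundle (fun x : M => TangentSpace 𝓘(ℝ, E) x)]
    [IsContMDiffRiemannianBundle 𝓘(ℝ, E) ∞ E (fun x : M => TangentSpace 𝓘(ℝ, E) x)]
    [IsRiemannianManifold 𝓘(ℝ, E) M]
    (X : Set M) (hXcompact : IsCompact X) (hXconvex : SVRRFW.GeodesicallyConvex E X)
    (L : ℝ) (hL : 0 ≤ L) (Δ₀ : ℝ) :
    ∃ C : ℝ, ∀ (m : ℕ) (φ : Fin m → M → ℝ), 0 < m →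
      (∀ i, SVRRFW.LSmoothOn E X L (φ i)) →
      SVRRFW.GConvexOn E X (SVRRFW.objective φ) →
      ∀ xstar ∈ X, IsMinOn (SVRRFW.objective φ) X xstar →
      ∀ x0 ∈ X, SVRRFW.objective φ x0 - SVRRFW.objective φ xstar ≤ Δ₀ →
      ∀ rlo : (x : M) → TangentSpace 𝓘(ℝ, E) x → M, SVRRFW.IsLinearOracle E X rlo →
      ∀ K S : ℕ, 1 ≤ K → 1 ≤ S →
      ∀ (Ω : Type*) [MeasurableSpace Ω] (μ : Measure Ω) [IsProbabilityMeasure μ]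
        (i : ℕ → ℕ → Fin (K ^ 2) → Ω → Fin m), SVRRFW.IsUniformSampling μ m (K ^ 2) K S i →
        let η : ℝ := 1 / Real.sqrt (K * S)
        let gap : M → ℝ := fun x => SVRRFW.objective φ x - SVRRFW.objective φ xstar
        let sample : Ω → ℕ → ℕ → Fin (K ^ 2) → Fin m := fun o s k l => i s k l o
        let xhat : Ω → M := fun o => SVRRFW.anchor E φ rlo η K (sample o) x0 S
        let x : ℕ → ℕ → Ω → M := fun s k o => SVRRFW.iterate E φ rlo η K (sample o) x0 s k
        (Integrable (fun o => gap (xhat o)) μ ∧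
          ∫ o, gap (xhat o) ∂μ ≤ C / Real.sqrt (K * S)) ∧
        (∀ s < S, ∀ k < K, Integrable (fun o => gap (x s k o)) μ) ∧
          (1 / ((K : ℝ) * S)) * ∑ s ∈ Finset.range S, ∑ k ∈ Finset.range K,
            ∫ o, gap (x s k o) ∂μ ≤ C / Real.sqrt (K * S) := by
  obtain ⟨D, hD'⟩ := Metric.isBounded_iff.1 hXcompact.isBounded
  have hD : ∀ x ∈ X, ∀ y ∈ X, dist x y ≤ D := fun x hx y hy => hD' hx hy
  -- `5 / 2 = 2 + 1 / 2`: the noise contributes `2Dη · LDη`, the curvature term of the descent lemma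
  -- `LD²η²/2`.
  refine ⟨Δ₀ + 5 / 2 * (L * D ^ 2), ?_⟩
  intro m φ hm hφ hconv xs hxs hmin x0 hx0 hgap rlo hrlo K S hK hS Ω _ μ _ i hi η gap sample xhat x
  have hKS : 0 < K * S := Nat.mul_pos hK hS
  have hKS' : (1 : ℝ) ≤ K * S := by exact_mod_cast hKS
  have hsq : 1 ≤ √((K : ℝ) * S) := Real.one_le_sqrt.2 hKS'
  have hsq0 : 0 < √((K : ℝ) * S) := one_pos.trans_le hsq
  have hη : η ∈ Icc (0 : ℝ) 1 := ⟨by positivity, (div_le_one hsq0).2 hsq⟩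
  have hc : 0 ≤ 5 / 2 * (L * D ^ 2) := by positivity
  have hgap0 : ∀ y ∈ X, 0 ≤ gap y := fun y hy => sub_nonneg.2 (hmin hy)
  have hΔ : 0 ≤ Δ₀ := (hgap0 x0 hx0).trans hgap
  have hΦ := SVRRFW.LSmoothOn.objective hm hφ
  have hmem : ∀ s k o, x s k o ∈ X := fun s k o =>
    SVRRFW.iterate_mem hXconvex hrlo hη (sample o) hx0 s k
  -- The case `k = K` is included because the recursion at `K - 1` integrates the gap at the end of
  -- the epoch.
  have hint : ∀ s < S, ∀ k ≤ K, Integrable (fun o => gap (x s k o)) μ := fun s hs k hk =>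
    hi.integrable hm (fun I => gap (SVRRFW.iterate E φ rlo η K I x0 s k)) fun I J h => by
      rw [SVRRFW.iterate_congr x0 (fun s' hs' => h s' (hs'.trans hs))
        (fun k' hk' => h s hs k' (hk'.trans_le hk))]
  have hinthat : Integrable (fun o => gap (xhat o)) μ :=
    hi.integrable hm (fun I => gap (SVRRFW.anchor E φ rlo η K I x0 S)) fun I J h => by
      rw [SVRRFW.anchor_congr x0 S h]
  have hrec := SVRRFW.nested_contraction_le (e := fun s k => ∫ o, gap (x s k o) ∂μ) (K := K)
    (S := S) (Δ := Δ₀) hη (by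
      have h0 : ∀ o, x 0 0 o = x0 := fun _ => rfl
      simp only [h0, integral_const, probReal_univ, one_smul]
      exact hgap)
    (fun s k => integral_nonneg fun o => hgap0 _ (hmem s k o)) hc (fun s => rfl) ?_
  · obtain ⟨h1, h2⟩ := hrec
    refine ⟨⟨hinthat, ?_⟩, fun s hs k hk => hint s hs k hk.le, ?_⟩
    -- The output is definitionally the starting iterate of the fictitious epoch `S`.
    · refine (show _ ≤ _ from h1).trans ?_
      have h3 := SVRRFW.one_sub_inv_sqrt_pow_le hKS
      push_cast at h3
      refine (add_le_add_left (mul_le_mul_of_nonneg_right h3 hΔ) _).trans (le_of_eq ?_)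
      simp only [η]
      ring
    -- The step size makes the accumulated error `c * η ^ 2 * (K * S)` equal to `c`, and the
    -- averaging weight `1 / (K * S)` equal to `η * η`. One factor `η` is absorbed by the telescoped
    -- sum, the other is the rate.
    · have h4 : η ^ 2 * (K * S) = 1 := by
        simp only [η]
        rw [div_pow, Real.sq_sqrt (by positivity)]
        field_simp
      have h5 : 1 / ((K : ℝ) * S) = η * η := by
        rw [div_eq_iff (by positivity), ← sq, h4]
      rw [h5, mul_assoc, div_eq_mul_one_div, mul_comm _ (1 / _)]
      refine mul_le_mul_of_nonneg_left (h2.trans (le_of_eq ?_)) hη.1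
      rw [mul_assoc, h4, mul_one]
  · intro s hs k hk
    have hstep : ∀ o, gap (x s (k + 1) o) ≤ (1 - η) * gap (x s k o) + 2 * D * η *
        ‖SVRRFW.vrGrad E φ (sample o s k) (SVRRFW.anchor E φ rlo η K (sample o) x0 s) (x s k o) -
          SVRRFW.rgrad E (SVRRFW.objective φ) (x s k o)‖ + L * D ^ 2 / 2 * η ^ 2 := fun o =>
      hrlo.step_le hL hΦ hXconvex hD hconv (hmem s k o) hxs _ hη
    have hD0 : 0 ≤ D := dist_nonneg.trans (hD x0 hx0 x0 hx0)
    have hnoise := SVRRFW.integral_norm_vrGrad_sub_le hL hm hφ hXconvex hD hrlo hη hi hx0 hs hk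
    have hnint : Integrable (fun o => ‖SVRRFW.vrGrad E φ (sample o s k)
        (SVRRFW.anchor E φ rlo η K (sample o) x0 s) (x s k o) -
          SVRRFW.rgrad E (SVRRFW.objective φ) (x s k o)‖) μ :=
      hi.integrable hm (fun I => ‖SVRRFW.vrGrad E φ (I s k)
        (SVRRFW.anchor E φ rlo η K I x0 s) (SVRRFW.iterate E φ rlo η K I x0 s k) -
          SVRRFW.rgrad E (SVRRFW.objective φ) (SVRRFW.iterate E φ rlo η K I x0 s k)‖)
        fun I J h => by
          rw [SVRRFW.iterate_congr x0 (fun s' hs' => h s' (hs'.trans hs))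
            (fun k' hk' => h s hs k' (hk'.trans hk)),
            SVRRFW.anchor_congr x0 s (fun s' hs' => h s' (hs'.trans hs)), h s hs k hk]
    have hi1 := (hint s hs k hk.le).const_mul (1 - η)
    have hi2 := hnint.const_mul (2 * D * η)
    have hi3 : Integrable (fun o => (1 - η) * gap (x s k o) + 2 * D * η *
        ‖SVRRFW.vrGrad E φ (sample o s k) (SVRRFW.anchor E φ rlo η K (sample o) x0 s) (x s k o) -
          SVRRFW.rgrad E (SVRRFW.objective φ) (x s k o)‖) μ := hi1.add hi2
    have h6 := integral_mono (hint s hs (k + 1) hk) (hi3.add (integrable_const _)) hstep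
    simp only [Pi.add_apply] at h6
    rw [integral_add hi3 (integrable_const _), integral_add hi1 hi2, integral_const_mul,
      integral_const_mul, integral_const, probReal_univ, one_smul] at h6
    have h7 := mul_le_mul_of_nonneg_left hnoise (by have := hη.1; positivity : 0 ≤ 2 * D * η)
    refine h6.trans ?_
    linarith
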